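/- Let $\mathbb{F}_q$ be a finite field of odd characteristic, let $t\in\mathbb{F}_q$ be a fixed (arbitrary) non-square, and let $L$ be a finite-dimensional nilpotent Lie algebra over $\mathbb{F}_q$. For $x\in L$ the breadth $b(x)$ is the codimension in $L$ of the centralizer $C_L(x)=\{y\in L : [x,y]=0\}$, and $L$ is of breadth type $(0,3)$ if $\{b(x) : x\in L\}=\{0,3\}$. A finite-dimensional Lie algebra $\mathfrak g$ with derived subalgebra $\mathfrak g'=[\mathfrak g,\mathfrak g]$ is a Camina Lie algebra if $[x,\mathfrak g]=\mathfrak g'$ for all $x\in\mathfrak g\setminus\mathfrak g'$; it is $2$-step if it is nilpotent of nilpotency class exactly $2$. Let $\mathcal L_3=FL_4/[FL_4,[FL_4,FL_4]]$ be the free $2$-step nilpotent Lie algebra over $\mathbb F_q$ on four generators $x_1,x_2,x_3,x_4$, where $FL_4$ is the free Lie algebra on four generators. Then $L$ is of breadth type $(0,3)$ if and only if $L\cong\mathfrak g\oplus A$ (direct sum of Lie algebras) for some abelian Lie algebra $A$ and some Lie algebra $\mathfrak g$ over $\mathbb{F}_q$ that satisfies one of the following: (i) $\mathfrak g$ is a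 $2$-step nilpotent Camina Lie algebra with $\dim\mathfrak g'=3$; (ii) $\mathfrak g\cong\mathcal L_3$; (iii) $\mathfrak g\cong\mathcal L_3/I$, where $I=\langle [x_1,x_2]+[x_3,x_4]\rangle$ is the central ideal spanned by the displayed element; (iv) $\mathfrak g\cong\mathcal L_3/J$, where $J=\langle [x_1,x_2]+[x_3,x_4],\ [x_1,x_3]+t[x_2,x_4]\rangle$ is the central ideal spanned by the displayed elements. -/

import Mathlib

universe u v

/-- The breadth `b(x)` of an element `x` of a Lie algebra `L`: the codimension in `L` of the
centralizer `C_L(x) = {y | ⁅x, y⁆ = 0}`, which is the kernel of `ad x`. -/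
noncomputable def lieBreadth (F : Type*) {L : Type*} [Field F] [LieRing L] [LieAlgebra F L]
    (x : L) : ℕ :=
  Module.finrank F (L ⧸ LinearMap.ker (LieAlgebra.ad F L x : L →ₗ[F] L))

/-- The breadth type of `L`, as the set of all breadths of elements of `L`.
Breadth type `(m₀, m₁, …, m_r)` with `m₀ < m₁ < ⋯ < m_r` means that this set
is `{m₀, m₁, …, m_r}`. -/
def lieBreadthType (F L : Type*) [Field F] [LieRing L] [LieAlgebra F L] : Set ℕ :=
  Set.range (fun x : L => lieBreadth F x)

/-- The derived subalgebra `L' = [L, L]`. -/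
def lieDerived (F L : Type*) [Field F] [LieRing L] [LieAlgebra F L] : LieIdeal F L :=
  ⁅(⊤ : LieIdeal F L), (⊤ : LieIdeal F L)⁆

/-- `L` is a Camina Lie algebra: it is finite dimensional and `[x, L] = L'` for all
`x ∈ L \ L'`, where `[x, L] = {⁅x, y⁆ | y ∈ L}`. -/
def IsCaminaLie (F L : Type*) [Field F] [LieRing L] [LieAlgebra F L] : Prop :=
  Module.Finite F L ∧
    ∀ x : L, x ∉ lieDerived F L →
      Set.range (fun y : L => ⁅x, y⁆) = (lieDerived F L : Set L)

/-- `L` is `c`-step nilpotent: nilpotent, of nilpotency class exactly `c`. -/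
def IsStepNilpotentLie (L : Type*) [LieRing L] (c : ℕ) : Prop :=
  LieRing.IsNilpotent L ∧ LieModule.nilpotencyLength L L = c

/-- The free `2`-step nilpotent Lie algebra on `n` generators: the free Lie algebra `FL` on `n`
generators modulo the ideal `[FL, [FL, FL]]`. -/
abbrev FreeTwoStepLie (F : Type*) [Field F] (n : ℕ) : Type _ :=
  FreeLieAlgebra F (Fin n) ⧸
    (⁅(⊤ : LieIdeal F (FreeLieAlgebra F (Fin n))),
      lieDerived F (FreeLieAlgebra F (Fin n))⁆ : LieIdeal F (FreeLieAlgebra F (Fin n)))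

namespace FreeTwoStepLie

/-- The standard generators of the free `2`-step nilpotent Lie algebra, numbered from `0`. -/
noncomputable def gen (F : Type*) [Field F] (n : ℕ) (i : Fin n) : FreeTwoStepLie F n :=
  LieSubmodule.Quotient.mk (FreeLieAlgebra.of F i)

/-- With `x₁, x₂, x₃, x₄` the generators `gen 0, …, gen 3`: the ideal generated by
`⁅x₁, x₂⁆ + ⁅x₃, x₄⁆`. -/
noncomputable def idealOne (F : Type*) [Field F] : LieIdeal F (FreeTwoStepLie F 4) :=
  LieSubmodule.lieSpan F (FreeTwoStepLie F 4)
    {⁅gen F 4 0, gen F 4 1⁆ + ⁅gen F 4 2, gen F 4 3⁆}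

/-- With `x₁, x₂, x₃, x₄` the generators `gen 0, …, gen 3`: the ideal generated by
`⁅x₁, x₂⁆ + ⁅x₃, x₄⁆` and `⁅x₁, x₃⁆ + t ⁅x₂, x₄⁆`. -/
noncomputable def idealTwo (F : Type*) [Field F] (t : F) : LieIdeal F (FreeTwoStepLie F 4) :=
  LieSubmodule.lieSpan F (FreeTwoStepLie F 4)
    {⁅gen F 4 0, gen F 4 1⁆ + ⁅gen F 4 2, gen F 4 3⁆,
      ⁅gen F 4 0, gen F 4 2⁆ + t • ⁅gen F 4 1, gen F 4 3⁆}

end FreeTwoStepLie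

/-! Let `C` be a complement of the centre. The bracket restricts to an alternating map `B` on `C`
whose nonzero elements all have rank 3. Once brackets are known to be central (`lie_mem_center`),
`L` is the two-step algebra of `B` times an abelian factor (`exists_equiv_twoStepLie_prod`), and
what remains is to classify such maps.

The heart is a dichotomy, `range_le_range_or_finrank_eq_four`. If `v ≠ 0` commutes with `y`, the
image of `y` lies in the image of `v` (`range_le_range_of_apply_eq_zero`). Hence the vectors whose
image lies in that of `x` form a space containing the kernel of `B x`, and this space has dimension
at most 2 unless some single image contains all others. So without such an image `dim C` is 4 or 5,
and 5 would give a partition of the space into planes, which counting forbids. With such an image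
the derived algebra equals it and has dimension 3: the Camina case.

If `dim C = 4`, commuting vectors are proportional. Viewed as a map on bivectors, `B` then has a
kernel without nonzero decomposable elements, that is, anisotropic for the Plücker quadratic form. A
kernel of dimension 0, 1 or 2 gives the three quotients of the free algebra, after the normal forms
`exists_linearIndependent_relation` and `exists_linearIndependent_two_relations`. One fixed
non-square `t` suffices because the product of two non-squares in a finite field is a square. The
converse for these three algebras is the same anisotropy, read in Plücker coordinates. -/

open Module

/-! ### Alternating maps of constant rank 3. -/

section AlternatingMaps

variable {F V W : Type*} [Field F] [AddCommGroup V] [Module F V] [AddCommGroup W] [Module F W]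

theorem finrank_map_add_finrank_inf_ker [FiniteDimensional F V] (f : V →ₗ[F] W)
    (N : Submodule F V) :
    finrank F (N.map f) + finrank F (N ⊓ LinearMap.ker f : Submodule F V) = finrank F N := by
  have h := LinearMap.finrank_range_add_finrank_ker (f.domRestrict N)
  rw [LinearMap.range_domRestrict] at h
  have e : Submodule.map N.subtype (LinearMap.ker (f.domRestrict N)) = N ⊓ LinearMap.ker f := by
    ext x
    simp only [Submodule.mem_map, LinearMap.mem_ker, Submodule.mem_inf]
    constructor
    · rintro ⟨y, hy, rfl⟩
      exact ⟨y.2, hy⟩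
    · rintro ⟨h1, h2⟩
      exact ⟨⟨x, h1⟩, h2, rfl⟩
  rw [← e, Submodule.finrank_map_subtype_eq]
  exact h

/-- If `f + g` and `f - g` have rank at most one and so does `g`, then `f` has rank at most one. -/
theorem finrank_range_le_one_of_pencil [FiniteDimensional F V] [FiniteDimensional F W]
    (h2 : (2 : F) ≠ 0) (f g : V →ₗ[F] W)
    (hg : finrank F (LinearMap.range g) ≤ 1)
    (h₁ : finrank F (LinearMap.range (f + g)) ≤ 1)
    (h₃ : finrank F (LinearMap.range (f - g)) ≤ 1) :
    finrank F (LinearMap.range f) ≤ 1 := by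
  -- On the kernel of `g` both `f + g` and `f - g` agree with `f`. If their images meet trivially,
  -- `f` vanishes there and its rank is at most that of `g`. Otherwise the two images are the same
  -- line, which contains the image of `f = ((f + g) + (f - g)) / 2`.
  by_cases hd : LinearMap.range (f + g) ⊓ LinearMap.range (f - g) = ⊥
  · have hk : LinearMap.ker g ≤ LinearMap.ker f := by
      intro x hx
      rw [LinearMap.mem_ker] at hx ⊢
      have : f x ∈ LinearMap.range (f + g) ⊓ LinearMap.range (f - g) :=
        ⟨⟨x, by simp [hx]⟩, ⟨x, by simp [hx]⟩⟩
      rw [hd] at this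
      simpa using this
    have e1 := LinearMap.finrank_range_add_finrank_ker f
    have e2 := LinearMap.finrank_range_add_finrank_ker g
    have := Submodule.finrank_mono hk
    omega
  · have hpos : 1 ≤ finrank F
        (LinearMap.range (f + g) ⊓ LinearMap.range (f - g) : Submodule F W) := by
      rw [Nat.one_le_iff_ne_zero]
      exact fun h => hd (Submodule.finrank_eq_zero.mp h)
    have e1 : LinearMap.range (f + g) ⊓ LinearMap.range (f - g) = LinearMap.range (f + g) :=
      Submodule.eq_of_le_of_finrank_le inf_le_left (h₁.trans hpos)
    have e2 : LinearMap.range (f + g) ⊓ LinearMap.range (f - g) = LinearMap.range (f - g) :=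
      Submodule.eq_of_le_of_finrank_le inf_le_right (h₃.trans hpos)
    refine le_trans (Submodule.finrank_mono ?_) h₁
    rintro _ ⟨x, rfl⟩
    have m1 : (f + g) x ∈ LinearMap.range (f + g) := ⟨x, rfl⟩
    have m2 : (f - g) x ∈ LinearMap.range (f + g) := by
      rw [← e1, e2]; exact ⟨x, rfl⟩
    have : f x = (2 : F)⁻¹ • ((f + g) x + (f - g) x) := by
      simp only [LinearMap.add_apply, LinearMap.sub_apply]
      rw [show f x + g x + (f x - g x) = (2 : F) • f x by rw [two_smul]; abel, smul_smul,
        inv_mul_cancel₀ h2, one_smul]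
    rw [this]
    exact Submodule.smul_mem _ _ (Submodule.add_mem _ m1 m2)

variable {B : V →ₗ[F] V →ₗ[F] W}

theorem LinearMap.IsAlt.swap (hB : B.IsAlt) (x y : V) : B x y = -B y x := (hB.neg y x).symm

/-- In an alternating map all of whose nonzero elements have rank `3`, an element commuting with
`v` is sent into the image of `v` by every `u` not commuting with `v`. -/
theorem mem_range_of_apply_eq_zero_of_ne_zero [FiniteDimensional F V] [FiniteDimensional F W]
    (h2 : (2 : F) ≠ 0) (hB : B.IsAlt)
    (h3 : ∀ v, v ≠ 0 → finrank F (LinearMap.range (B v)) = 3) {v y u : V}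
    (hy : B v y = 0) (hu : B v u ≠ 0) : B u y ∈ LinearMap.range (B v) := by
  by_contra hn
  have huv : B u v ≠ 0 := by rw [hB.swap]; simpa using hu
  -- Since `v` commutes with `v` and `y`, this plane lies in the images of `u`, `v + u` and `v - u`
  -- alike. Modulo `P` those three have rank at most 1, hence so does `v` by the pencil lemma. Then
  -- the image of `v` meets `P` in dimension at least 2, so it contains `B u y`.
  set P : Submodule F W := Submodule.span F {B u v, B u y} with hP
  have hlin : LinearIndependent F ![B u v, B u y] := by
    rw [LinearIndependent.pair_iff' huv]
    intro a ha
    apply hn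
    rw [← ha, hB.swap]
    exact ⟨-(a • u), by simp⟩
  have hPrank : finrank F P = 2 := by
    have := finrank_span_eq_card hlin
    rwa [Matrix.range_cons_cons_empty, Fintype.card_fin] at this
  have hrank : ∀ x, x ≠ 0 → P ≤ LinearMap.range (B x) →
      finrank F (LinearMap.range (P.mkQ ∘ₗ B x)) ≤ 1 := by
    intro x hx hPx
    have h := finrank_map_add_finrank_inf_ker P.mkQ (LinearMap.range (B x))
    rw [Submodule.ker_mkQ, inf_eq_right.mpr hPx, hPrank, h3 x hx] at h
    rw [LinearMap.range_comp]
    omega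
  have hvv := hB v
  have hvne : v ≠ 0 := by rintro rfl; simp at hu
  have hune : u ≠ 0 := by rintro rfl; simp at hu
  have key := finrank_range_le_one_of_pencil h2 (P.mkQ ∘ₗ B v) (P.mkQ ∘ₗ B u)
    (hrank u hune (by
      rw [hP, Submodule.span_le]
      rintro _ (rfl | rfl)
      exacts [⟨v, rfl⟩, ⟨y, rfl⟩]))
    (by
      rw [← LinearMap.comp_add, ← map_add]
      refine hrank _ ?_ ?_
      · intro h
        apply hu
        rw [eq_neg_of_add_eq_zero_left h]; simp [hB u]
      · rw [hP, Submodule.span_le]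
        rintro _ (rfl | rfl)
        exacts [⟨v, by simp [hvv]⟩, ⟨y, by simp [hy]⟩])
    (by
      rw [← LinearMap.comp_sub, ← map_sub]
      refine hrank _ ?_ ?_
      · intro h
        apply hu
        rw [sub_eq_zero.mp h]; simp [hB u]
      · rw [hP, Submodule.span_le]
        rintro _ (rfl | rfl)
        exacts [⟨-v, by simp [hvv]⟩, ⟨-y, by simp [hy]⟩])
  have h := finrank_map_add_finrank_inf_ker P.mkQ (LinearMap.range (B v))
  rw [Submodule.ker_mkQ, h3 v hvne] at h
  rw [LinearMap.range_comp] at key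
  have h4 : finrank F P ≤ finrank F (LinearMap.range (B v) ⊓ P : Submodule F W) := by omega
  have h5 := Submodule.eq_of_le_of_finrank_le inf_le_right h4
  apply hn
  have : B u y ∈ P := Submodule.subset_span (by simp)
  rw [← h5] at this
  exact this.1

/-- The preceding lemma covers every `u` not commuting with `v`. A `u` that does commute is the
difference of two that do not, `u + u₀` and `u₀`. -/
theorem range_le_range_of_apply_eq_zero [FiniteDimensional F V] [FiniteDimensional F W]
    (h2 : (2 : F) ≠ 0) (hB : B.IsAlt)
    (h3 : ∀ v, v ≠ 0 → finrank F (LinearMap.range (B v)) = 3) {v y : V} (hv : v ≠ 0)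
    (hy : B v y = 0) : LinearMap.range (B y) ≤ LinearMap.range (B v) := by
  have key : ∀ u, B u y ∈ LinearMap.range (B v) := by
    intro u
    by_cases hu : B v u = 0
    · obtain ⟨u₀, hu₀⟩ : ∃ u₀, B v u₀ ≠ 0 := by
        by_contra! h
        have := h3 v hv
        rw [show B v = 0 from LinearMap.ext h, LinearMap.range_zero, finrank_bot] at this
        omega
      have m1 := mem_range_of_apply_eq_zero_of_ne_zero h2 hB h3 hy hu₀
      have m2 := mem_range_of_apply_eq_zero_of_ne_zero h2 hB h3 (u := u + u₀) hy
        (by simpa [hu] using hu₀)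
      have := Submodule.sub_mem _ m2 m1
      simpa using this
    · exact mem_range_of_apply_eq_zero_of_ne_zero h2 hB h3 hy hu
  rintro _ ⟨u, rfl⟩
  rw [hB.swap]
  exact Submodule.neg_mem _ (key u)

/-- A vector space of dimension `5` over a finite field has no partition by planes. -/
theorem not_partition_by_planes [Finite F] [FiniteDimensional F V] (hV : finrank F V = 5)
    (P : V → Submodule F V) (hP : ∀ x, x ≠ 0 → finrank F (P x) = 2)
    (hself : ∀ x, x ∈ P x) (heq : ∀ x y, x ≠ 0 → y ≠ 0 → y ∈ P x → P y = P x) : False := by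
  classical
  have : Finite V := Module.finite_of_finite F
  have := Fintype.ofFinite F
  have := Fintype.ofFinite V
  set q := Fintype.card F with hq
  have hq1 : 1 < q := Fintype.one_lt_card
  set s : Finset V := Finset.univ.filter (· ≠ 0) with hs
  have h1 : s.card = q ^ 5 - 1 := by
    rw [hs, Finset.filter_ne', Finset.card_erase_of_mem (Finset.mem_univ _), Finset.card_univ,
      Module.card_eq_pow_finrank (K := F), hV]
  have h2 := Finset.card_eq_sum_card_image P s
  have h4 : ∀ b ∈ s.image P, (s.filter (fun a => P a = b)).card = q ^ 2 - 1 := by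
    intro b hb
    obtain ⟨x, hx, rfl⟩ := Finset.mem_image.mp hb
    have hx0 : x ≠ 0 := (Finset.mem_filter.mp hx).2
    have : s.filter (fun a => P a = P x) =
        (Finset.univ.filter (fun a => a ∈ P x)).erase 0 := by
      ext a
      simp only [hs, Finset.mem_filter, Finset.mem_univ, true_and, Finset.mem_erase]
      constructor
      · rintro ⟨ha, h⟩
        exact ⟨ha, h ▸ hself a⟩
      · rintro ⟨ha, h⟩
        exact ⟨ha, heq x a hx0 ha h⟩
    rw [this, Finset.card_erase_of_mem (by simp), ← Fintype.card_subtype,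
      ← hP x hx0, hq]
    congr 1
    exact Module.card_eq_pow_finrank (K := F) (V := P x)
  rw [Finset.sum_congr rfl h4, Finset.sum_const, h1, smul_eq_mul] at h2
  have hdvd : q ^ 2 - 1 ∣ q ^ 5 - 1 := ⟨_, by rw [h2, mul_comm]⟩
  have hz : ((q : ℤ) ^ 2 - 1) ∣ (q : ℤ) ^ 5 - 1 := by
    have := Int.natCast_dvd_natCast.mpr hdvd
    rwa [Nat.cast_sub (Nat.one_le_pow _ _ (by omega)), Nat.cast_sub (Nat.one_le_pow _ _ (by omega)),
      Nat.cast_pow, Nat.cast_pow, Nat.cast_one] at this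
  have hz2 : ((q : ℤ) ^ 2 - 1) ∣ (q : ℤ) - 1 := by
    -- Division of `q ^ 5 - 1` by `q ^ 2 - 1` leaves the remainder `q - 1`, which is positive and
    -- too small to be a multiple.
    have e : (q : ℤ) - 1 = ((q : ℤ) ^ 5 - 1) - ((q : ℤ) ^ 2 - 1) * (q ^ 3 + q) := by ring
    rw [e]
    exact dvd_sub hz (dvd_mul_right _ _)
  have hqz : (1 : ℤ) < q := by exact_mod_cast hq1
  have := Int.le_of_dvd (by linarith) hz2
  nlinarith

/-- The dichotomy for alternating maps of constant rank `3` over a finite field of odd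
characteristic. -/
theorem range_le_range_or_finrank_eq_four [Finite F] [FiniteDimensional F V]
    [FiniteDimensional F W] [Nontrivial V]
    (h2 : (2 : F) ≠ 0) (hB : B.IsAlt)
    (h3 : ∀ v, v ≠ 0 → finrank F (LinearMap.range (B v)) = 3) :
    (∃ x, x ≠ 0 ∧ ∀ y, LinearMap.range (B y) ≤ LinearMap.range (B x)) ∨ finrank F V = 4 := by
  rw [or_iff_not_imp_left]
  intro hne
  push Not at hne
  have hrk : ∀ x y, x ≠ 0 → y ≠ 0 → LinearMap.range (B y) ≤ LinearMap.range (B x) →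
      LinearMap.range (B y) = LinearMap.range (B x) := fun x y hx hy h =>
    Submodule.eq_of_le_of_finrank_eq h (by rw [h3 x hx, h3 y hy])
  -- The vectors whose image lies in that of `x`; since all ranks are 3, the nonzero ones have the
  -- same image as `x` when `x ≠ 0`.
  let P : V → Submodule F V := fun x =>
    LinearMap.ker (B.compr₂ (LinearMap.range (B x)).mkQ)
  have hPmem : ∀ x y, y ∈ P x ↔ LinearMap.range (B y) ≤ LinearMap.range (B x) := by
    intro x y
    simp only [P, LinearMap.mem_ker, LinearMap.ext_iff, LinearMap.compr₂_apply,
      LinearMap.zero_apply, Submodule.mkQ_apply, Submodule.Quotient.mk_eq_zero]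
    constructor
    · rintro h _ ⟨u, rfl⟩
      exact h u
    · exact fun h u => h ⟨u, rfl⟩
  have hP2 : ∀ x, x ≠ 0 → finrank F (P x) ≤ 2 := by
    intro x hx
    obtain ⟨y, hy⟩ := hne x hx
    have hy0 : y ≠ 0 := by
      rintro rfl
      simp at hy
    -- A nonzero `z` in `P x` has the image of `x`; if it commuted with `y`, the image of `y` would
    -- lie in that of `x`. So `B y` embeds `P x` into the intersection of the two images, of
    -- dimension at most 2.
    have hinj : P x ⊓ LinearMap.ker (B y) = ⊥ := by
      rw [eq_bot_iff]
      rintro z ⟨hz1, hz2⟩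
      rw [SetLike.mem_coe, hPmem] at hz1
      rw [Submodule.mem_bot]
      by_contra hz0
      apply hy
      rw [← hrk x z hx hz0 hz1]
      apply range_le_range_of_apply_eq_zero h2 hB h3 hz0
      rw [hB.swap]
      simpa using hz2
    have h := finrank_map_add_finrank_inf_ker (B y) (P x)
    rw [hinj, finrank_bot, add_zero] at h
    have hle : (P x).map (B y) ≤ LinearMap.range (B y) ⊓ LinearMap.range (B x) := by
      rintro _ ⟨z, hz, rfl⟩
      refine ⟨⟨z, rfl⟩, ?_⟩
      rw [SetLike.mem_coe, hPmem] at hz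
      rw [hB.swap]
      exact Submodule.neg_mem _ (hz ⟨y, rfl⟩)
    have hlt : LinearMap.range (B y) ⊓ LinearMap.range (B x) < LinearMap.range (B y) :=
      lt_of_le_of_ne inf_le_left fun h => hy (inf_eq_left.mp h)
    have := Submodule.finrank_mono hle
    have := Submodule.finrank_lt_finrank_of_lt hlt
    have := h3 y hy0
    omega
  have hker : ∀ x, x ≠ 0 → finrank F V = 3 + finrank F (LinearMap.ker (B x)) := fun x hx => by
    rw [← h3 x hx, LinearMap.finrank_range_add_finrank_ker]
  have hkerP : ∀ x, x ≠ 0 → LinearMap.ker (B x) ≤ P x := fun x hx y hy =>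
    (hPmem x y).mpr (range_le_range_of_apply_eq_zero h2 hB h3 hx hy)
  obtain ⟨x₀, hx₀⟩ := exists_ne (0 : V)
  -- In dimension 5 every kernel is a plane, so each `P x` with `x ≠ 0` is exactly a plane, and
  -- these are the classes of vectors with equal image.
  have h5 : finrank F V ≠ 5 := by
    intro hV
    refine not_partition_by_planes hV P (fun x hx => ?_) (fun x => ?_) (fun x y hx hy hxy => ?_)
    · have := Submodule.finrank_mono (hkerP x hx)
      have := hker x hx
      have := hP2 x hx
      omega
    · exact (hPmem x x).mpr le_rfl
    · have := hrk x y hx hy ((hPmem x y).mp hxy)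
      ext z
      rw [hPmem, hPmem, this]
  have hpos : 1 ≤ finrank F (LinearMap.ker (B x₀)) := by
    rw [Nat.one_le_iff_ne_zero]
    intro h
    have h0 : x₀ ∈ LinearMap.ker (B x₀) := hB x₀
    rw [Submodule.finrank_eq_zero.mp h] at h0
    exact hx₀ (by simpa using h0)
  have := Submodule.finrank_mono (hkerP x₀ hx₀)
  have := hker x₀ hx₀
  have := hP2 x₀ hx₀
  omega

theorem range_eq_top_of_forall_range_le {x : V}
    (hS : Submodule.span F {w | ∃ x y, B x y = w} = ⊤)
    (hle : ∀ y, LinearMap.range (B y) ≤ LinearMap.range (B x)) : LinearMap.range (B x) = ⊤ := by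
  rw [eq_top_iff, ← hS, Submodule.span_le]
  rintro _ ⟨u, v, rfl⟩
  exact hle u ⟨v, rfl⟩

end AlternatingMaps

/-! ### Normal forms in dimension four. -/

section NormalForms

variable {F V W : Type*} [Field F] [AddCommGroup V] [Module F V] [AddCommGroup W] [Module F W]

/-- An alternating 3 × 3 matrix is singular: its three entries above the diagonal, suitably signed
and reordered, are the coordinates of a vector in the kernel. -/
theorem exists_ker_of_isAlt_of_basis_three {ω : V →ₗ[F] V →ₗ[F] F} (hω : ω.IsAlt)
    {e : Fin 3 → V} (he : LinearIndependent F e) :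
    ∃ y ∈ Submodule.span F (Set.range e), y ≠ 0 ∧ ∀ i, ω y (e i) = 0 := by
  by_cases h0 : ω (e 0) (e 1) = 0 ∧ ω (e 0) (e 2) = 0
  · refine ⟨e 0, Submodule.subset_span ⟨0, rfl⟩, he.ne_zero 0, fun i => ?_⟩
    fin_cases i
    exacts [hω _, h0.1, h0.2]
  · refine ⟨ω (e 1) (e 2) • e 0 - ω (e 0) (e 2) • e 1 + ω (e 0) (e 1) • e 2, ?_, ?_, ?_⟩
    · refine add_mem (sub_mem ?_ ?_) ?_ <;>
        exact Submodule.smul_mem _ _ (Submodule.subset_span ⟨_, rfl⟩)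
    · intro h
      have := Fintype.linearIndependent_iff.mp he
        ![ω (e 1) (e 2), -ω (e 0) (e 2), ω (e 0) (e 1)] (by
          rw [Fin.sum_univ_three]
          simpa [sub_eq_add_neg] using h)
      exact h0 ⟨by simpa using this 2, by simpa using this 1⟩
    · intro i
      have h10 := hω.swap (e 1) (e 0)
      have h20 := hω.swap (e 2) (e 0)
      have h21 := hω.swap (e 2) (e 1)
      have a0 := hω (e 0)
      have a1 := hω (e 1)
      have a2 := hω (e 2)
      fin_cases i <;>
        simp [h10, h20, h21, a0, a1, a2] <;> ring

/-- An alternating form on a four-dimensional space with a nonzero vector in its radical has a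
radical of dimension at least two. -/
theorem exists_notMem_span_of_isAlt [FiniteDimensional F V] (hV : finrank F V = 4)
    {ω : V →ₗ[F] V →ₗ[F] F} (hω : ω.IsAlt) {x : V} (hx : x ≠ 0) (hωx : ω x = 0) :
    ∃ y, y ∉ Submodule.span F {x} ∧ ω y = 0 := by
  -- The form is degenerate on a complement of `x`, which has odd dimension; a radical vector there
  -- is also orthogonal to `x`.
  obtain ⟨E, hE⟩ := Submodule.exists_isCompl (Submodule.span F {x})
  have hE3 : finrank F E = 3 := by
    have := Submodule.finrank_add_eq_of_isCompl hE
    rw [finrank_span_singleton hx, hV] at this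
    omega
  let e := finBasisOfFinrankEq F E hE3
  have he : LinearIndependent F (E.subtype ∘ e) :=
    e.linearIndependent.map' _ (Submodule.ker_subtype E)
  have hspan : Submodule.span F (Set.range (E.subtype ∘ e)) = E := by
    rw [Set.range_comp, Submodule.span_image, e.span_eq, Submodule.map_top, Submodule.range_subtype]
  obtain ⟨y, hy, hy0, hye⟩ := exists_ker_of_isAlt_of_basis_three hω he
  rw [hspan] at hy
  refine ⟨y, fun hyx => hy0 ?_, ?_⟩
  · simpa using hE.disjoint.le_bot (show y ∈ _ ⊓ _ from ⟨hyx, hy⟩)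
  · have h1 : E ≤ LinearMap.ker (ω y) := by
      rw [← hspan, Submodule.span_le]
      rintro _ ⟨i, rfl⟩
      exact hye i
    have h2 : Submodule.span F {x} ≤ LinearMap.ker (ω y) := by
      rw [Submodule.span_le, Set.singleton_subset_iff, SetLike.mem_coe, LinearMap.mem_ker, hω.swap,
        hωx]
      simp
    have := sup_le h2 h1
    rw [hE.sup_eq_top, top_le_iff] at this
    exact LinearMap.ker_eq_top.mp this

variable {B : V →ₗ[F] V →ₗ[F] W}

/-- Rank 3 in dimension 4 leaves a one-dimensional kernel, and it contains `v`. -/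
theorem mem_span_singleton_of_apply_eq_zero [FiniteDimensional F V] (hV : finrank F V = 4)
    (hB : B.IsAlt) (h3 : ∀ v, v ≠ 0 → finrank F (LinearMap.range (B v)) = 3) {v w : V}
    (hv : v ≠ 0) (h : B v w = 0) : w ∈ Submodule.span F {v} := by
  have hle : Submodule.span F {v} ≤ LinearMap.ker (B v) := by
    rw [Submodule.span_le, Set.singleton_subset_iff]
    exact hB v
  have := LinearMap.finrank_range_add_finrank_ker (B v)
  rw [h3 v hv, hV] at this
  rw [Submodule.eq_of_le_of_finrank_eq hle (by rw [finrank_span_singleton hv]; omega)]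
  exact h

/-- The relation is a bivector in the kernel of `B`. With `p₀₁` as pivot, symplectic elimination
rewrites it as a sum of two decomposable bivectors. -/
theorem linearIndependent_of_relation [FiniteDimensional F V] (hV : finrank F V = 4)
    (hB : B.IsAlt) (h3 : ∀ v, v ≠ 0 → finrank F (LinearMap.range (B v)) = 3)
    {b : Fin 4 → V} (hb : LinearIndependent F b) {p₀₁ p₀₂ p₀₃ p₁₂ p₁₃ p₂₃ : F} (hp : p₀₁ ≠ 0)
    (hrel : p₀₁ • B (b 0) (b 1) + p₀₂ • B (b 0) (b 2) + p₀₃ • B (b 0) (b 3) +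
      p₁₂ • B (b 1) (b 2) + p₁₃ • B (b 1) (b 3) + p₂₃ • B (b 2) (b 3) = 0) :
    ∃ x : Fin 4 → V, LinearIndependent F x ∧ B (x 0) (x 1) + B (x 2) (x 3) = 0 := by
  -- The Pfaffian of the coefficients divided by `p₀₁`. It cannot vanish, since otherwise `x₀` and
  -- `x₁` would commute without being proportional.
  set c : F := p₂₃ + (p₁₂ * p₀₃ - p₁₃ * p₀₂) / p₀₁ with hc
  set x₀ := b 0 - (p₁₂ / p₀₁) • b 2 - (p₁₃ / p₀₁) • b 3 with hx₀
  set x₁ := p₀₁ • b 1 + p₀₂ • b 2 + p₀₃ • b 3 with hx₁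
  have h21 := hB.swap (b 2) (b 1)
  have h31 := hB.swap (b 3) (b 1)
  have h32 := hB.swap (b 3) (b 2)
  have h22 := hB (b 2)
  have h33 := hB (b 3)
  have hrel' : B x₀ x₁ + c • B (b 2) (b 3) = 0 := by
    rw [← hrel, hx₀, hx₁, hc]
    simp only [map_sub, map_add, map_smul, LinearMap.sub_apply, LinearMap.smul_apply,
      h21, h31, h32, h22, h33]
    match_scalars <;> field_simp
    ring
  have hcoord := Fintype.linearIndependent_iff.mp hb
  have hx₀ne : x₀ ≠ 0 := by
    intro h
    have := hcoord ![1, 0, -(p₁₂ / p₀₁), -(p₁₃ / p₀₁)] (by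
      rw [Fin.sum_univ_four, ← h, hx₀]
      simp
      abel) 0
    simp at this
  have hcne : c ≠ 0 := by
    intro h
    rw [h, zero_smul, add_zero] at hrel'
    obtain ⟨a, ha⟩ := Submodule.mem_span_singleton.mp
      (mem_span_singleton_of_apply_eq_zero hV hB h3 hx₀ne hrel')
    have := hcoord ![a, -p₀₁, a * -(p₁₂ / p₀₁) - p₀₂, a * -(p₁₃ / p₀₁) - p₀₃] (by
      rw [Fin.sum_univ_four, ← sub_eq_zero.mpr ha, hx₀, hx₁]
      simp
      module) 1
    simp at this
    exact hp this
  refine ⟨![x₀, x₁, c • b 2, b 3], ?_, by simpa using hrel'⟩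
  rw [Fintype.linearIndependent_iff]
  intro g hg
  have := hcoord ![g 0, g 1 * p₀₁, g 1 * p₀₂ + g 2 * c - g 0 * (p₁₂ / p₀₁),
    g 1 * p₀₃ + g 3 - g 0 * (p₁₃ / p₀₁)] (by
      rw [← hg, Fin.sum_univ_four, Fin.sum_univ_four, hx₀, hx₁]
      simp
      module)
  have t0 : g 0 = 0 := by simpa using this 0
  have t1 : g 1 = 0 := by simpa [hp] using this 1
  have t2 : g 2 = 0 := by simpa [t0, t1, hcne] using this 2
  have t3 : g 3 = 0 := by simpa [t0, t1] using this 3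
  intro i
  fin_cases i
  exacts [t0, t1, t2, t3]

/-- The pairs `i < j` in `Fin 4`. -/
def finFourPairs : Fin 6 → Fin 4 × Fin 4 :=
  ![(0, 1), (0, 2), (0, 3), (1, 2), (1, 3), (2, 3)]

theorem span_apply_eq_span_pairs (hB : B.IsAlt) (b : Basis (Fin 4) F V) :
    Submodule.span F {w | ∃ x y, B x y = w} =
      Submodule.span F
        (Set.range fun k => B (b (finFourPairs k).1) (b (finFourPairs k).2)) := by
  apply le_antisymm
  · rw [Submodule.span_le]
    rintro _ ⟨x, y, rfl⟩
    have hk : ∀ i j, B (b i) (b j) ∈ Submodule.span F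
        (Set.range fun k => B (b (finFourPairs k).1) (b (finFourPairs k).2)) := by
      have hs : ∀ k, B (b (finFourPairs k).1) (b (finFourPairs k).2) ∈ Submodule.span F
        (Set.range fun k => B (b (finFourPairs k).1) (b (finFourPairs k).2)) :=
        fun k => Submodule.subset_span ⟨k, rfl⟩
      intro i j
      wlog hij : i ≤ j generalizing i j
      · rw [hB.swap]
        exact neg_mem (this j i (le_of_not_ge hij))
      fin_cases i <;> fin_cases j <;>
        first
        | (exfalso; revert hij; decide)
        | (rw [hB]; exact zero_mem _)
        | exact hs 0
        | exact hs 1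
        | exact hs 2
        | exact hs 3
        | exact hs 4
        | exact hs 5
    rw [SetLike.mem_coe, ← b.sum_repr x, ← b.sum_repr y]
    simp only [map_sum, map_smul, LinearMap.sum_apply, LinearMap.smul_apply]
    exact Submodule.sum_mem _ fun i _ => Submodule.smul_mem _ _
      (Submodule.sum_mem _ fun j _ => Submodule.smul_mem _ _ (hk j i))
  · exact Submodule.span_mono (by rintro _ ⟨k, rfl⟩; exact ⟨_, _, rfl⟩)

theorem finrank_span_apply_le_six (hB : B.IsAlt) (b : Basis (Fin 4) F V) :
    finrank F (Submodule.span F {w | ∃ x y, B x y = w}) ≤ 6 := by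
  rw [span_apply_eq_span_pairs hB b]
  exact finrank_range_le_card _

/-- If the brackets of a four-dimensional space span less than the full exterior square then, in a
suitable basis, `[x₁, x₂] + [x₃, x₄] = 0`. -/
theorem exists_linearIndependent_relation [FiniteDimensional F V] (hV : finrank F V = 4)
    (hB : B.IsAlt) (h3 : ∀ v, v ≠ 0 → finrank F (LinearMap.range (B v)) = 3)
    (h6 : finrank F (Submodule.span F {w | ∃ x y, B x y = w}) < 6) :
    ∃ x : Fin 4 → V, LinearIndependent F x ∧ B (x 0) (x 1) + B (x 2) (x 3) = 0 := by
  let b := finBasisOfFinrankEq F V hV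
  have hdep : ¬ LinearIndependent F
      (fun k => B (b (finFourPairs k).1) (b (finFourPairs k).2)) := by
    intro h
    have := finrank_span_eq_card h
    rw [← span_apply_eq_span_pairs hB b, Fintype.card_fin] at this
    omega
  rw [Fintype.not_linearIndependent_iff] at hdep
  obtain ⟨p, hp, k, hk⟩ := hdep
  have hp' : p 0 • B (b 0) (b 1) + p 1 • B (b 0) (b 2) + p 2 • B (b 0) (b 3) +
      p 3 • B (b 1) (b 2) + p 4 • B (b 1) (b 3) + p 5 • B (b 2) (b 3) = 0 := by
    rw [← hp, Fin.sum_univ_six]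
    rfl
  have hl := b.linearIndependent
  have s : ∀ i j, B (b i) (b j) = -B (b j) (b i) := fun i j => hB.swap _ _
  have perm : ∀ i j k l : Fin 4, Function.Injective ![i, j, k, l] →
      LinearIndependent F ![b i, b j, b k, b l] := by
    intro i j k l h
    convert hl.comp _ h using 1
    ext m
    fin_cases m <;> rfl
  -- Permuting the basis moves a nonzero coefficient into the pivot position; the signs come from
  -- reversed pairs.
  fin_cases k
  · exact linearIndependent_of_relation hV hB h3 hl hk hp'
  · refine linearIndependent_of_relation hV hB h3 (perm 0 2 1 3 (by decide)) (p₀₁ := p 1)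
      (p₀₂ := p 0) (p₀₃ := p 2) (p₁₂ := -p 3) (p₁₃ := p 5) (p₂₃ := p 4) hk ?_
    simp [← hp', s 2 1]
    abel
  · refine linearIndependent_of_relation hV hB h3 (perm 0 3 1 2 (by decide)) (p₀₁ := p 2)
      (p₀₂ := p 0) (p₀₃ := p 1) (p₁₂ := -p 4) (p₁₃ := -p 5) (p₂₃ := p 3) hk ?_
    simp [← hp', s 3 1, s 3 2]
    abel
  · refine linearIndependent_of_relation hV hB h3 (perm 1 2 0 3 (by decide)) (p₀₁ := p 3)
      (p₀₂ := -p 0) (p₀₃ := p 4) (p₁₂ := -p 1) (p₁₃ := p 5) (p₂₃ := p 2) hk ?_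
    simp [← hp', s 1 0, s 2 0]
    abel
  · refine linearIndependent_of_relation hV hB h3 (perm 1 3 0 2 (by decide)) (p₀₁ := p 4)
      (p₀₂ := -p 0) (p₀₃ := p 3) (p₁₂ := -p 2) (p₁₃ := -p 5) (p₂₃ := p 1) hk ?_
    simp [← hp', s 1 0, s 3 0, s 3 2]
    abel
  · refine linearIndependent_of_relation hV hB h3 (perm 2 3 0 1 (by decide)) (p₀₁ := p 5)
      (p₀₂ := -p 1) (p₀₃ := -p 3) (p₁₂ := -p 2) (p₁₃ := -p 4) (p₂₃ := p 0) hk ?_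
    simp [← hp', s 2 0, s 3 0, s 3 1, s 2 1]
    abel

/-- If the brackets of a four-dimensional space span a space of dimension four, there are
`x₁, x₂` independent with `[x₂, V] ⊆ [x₁, V]`. -/
theorem exists_range_le_range [FiniteDimensional F V] [FiniteDimensional F W]
    (hV : finrank F V = 4)
    (hB : B.IsAlt) (h3 : ∀ v, v ≠ 0 → finrank F (LinearMap.range (B v)) = 3)
    (h4 : finrank F (Submodule.span F {w | ∃ x y, B x y = w}) = 4) {x : V} (hx : x ≠ 0) :
    ∃ y, y ∉ Submodule.span F {x} ∧ LinearMap.range (B y) ≤ LinearMap.range (B x) := by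
  set S := Submodule.span F {w | ∃ x y, B x y = w} with hS
  have hUS : LinearMap.range (B x) ≤ S := by
    rintro _ ⟨y, rfl⟩
    exact Submodule.subset_span ⟨x, y, rfl⟩
  obtain ⟨w, hwS, hw⟩ : ∃ w ∈ S, w ∉ LinearMap.range (B x) := by
    by_contra! h
    have := Submodule.finrank_mono (show S ≤ LinearMap.range (B x) from h)
    rw [h3 x hx] at this
    omega
  -- The image of `x` is a hyperplane of `S`, cut out by `l`. The form `l ∘ B` has `x` in its
  -- radical, hence a second independent vector `y` there, and the image of `y` is killed by `l`
  -- too.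
  obtain ⟨l, hl, hlU⟩ := Submodule.exists_le_ker_of_notMem hw
  have hinf : LinearMap.range (B x) = S ⊓ LinearMap.ker l := by
    apply Submodule.eq_of_le_of_finrank_le (le_inf hUS hlU)
    have hlt : S ⊓ LinearMap.ker l < S :=
      lt_of_le_of_ne inf_le_left fun h => hl (show w ∈ LinearMap.ker l from (inf_eq_left.mp h) hwS)
    have := Submodule.finrank_lt_finrank_of_lt hlt
    rw [h3 x hx]
    omega
  have hω : (B.compr₂ l).IsAlt := fun v => by simp [hB v]
  obtain ⟨y, hy, hy0⟩ := exists_notMem_span_of_isAlt hV hω hx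
    (by ext u; exact hlU ⟨u, rfl⟩)
  refine ⟨y, hy, ?_⟩
  rintro _ ⟨u, rfl⟩
  rw [hinf]
  exact ⟨Submodule.subset_span ⟨y, u, rfl⟩, LinearMap.congr_fun hy0 u⟩

/-- For independent `x₁`, `x₂` with the image of `x₂` inside that of `x₁`, brackets with `x₂` can be
rewritten as brackets with `x₁`. Doing so twice produces a quadratic relation; a square discriminant
would yield non-proportional commuting vectors. -/
theorem exists_linearIndependent_two_relations [Finite F] [FiniteDimensional F V]
    [FiniteDimensional F W] (h2 : (2 : F) ≠ 0) {t : F} (ht : ¬ IsSquare t)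
    (hV : finrank F V = 4)
    (hB : B.IsAlt) (h3 : ∀ v, v ≠ 0 → finrank F (LinearMap.range (B v)) = 3)
    (h4 : finrank F (Submodule.span F {w | ∃ x y, B x y = w}) = 4) :
    ∃ x : Fin 4 → V, LinearIndependent F x ∧ B (x 0) (x 1) + B (x 2) (x 3) = 0 ∧
      B (x 0) (x 2) + t • B (x 1) (x 3) = 0 := by
  have : Nontrivial V := Module.nontrivial_of_finrank_pos (R := F) (by omega)
  obtain ⟨x₁, hx₁⟩ := exists_ne (0 : V)
  obtain ⟨x₂, hx₂, hle⟩ := exists_range_le_range hV hB h3 h4 hx₁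
  obtain ⟨x₃, hx₃⟩ : ∃ x₃, x₃ ∉ Submodule.span F {x₁, x₂} := by
    by_contra! h
    have h5 := finrank_range_le_card (R := F) ![x₁, x₂]
    rw [Set.finrank, Matrix.range_cons_cons_empty, (Submodule.eq_top_iff'.mpr h), finrank_top, hV,
      Fintype.card_fin] at h5
    omega
  obtain ⟨y₄, hy₄⟩ := hle ⟨x₃, rfl⟩
  have hcomm : ∀ v w, v ≠ 0 → B v w = 0 → ∃ a : F, a • v = w := fun v w hv h =>
    Submodule.mem_span_singleton.mp (mem_span_singleton_of_apply_eq_zero hV hB h3 hv h)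
  have h12 : ∀ a b : F, a • x₁ + b • x₂ = 0 → a = 0 ∧ b = 0 := by
    intro a b hab
    have hb : b = 0 := by
      by_contra hb
      apply hx₂
      refine Submodule.mem_span_singleton.mpr ⟨-(b⁻¹ * a), ?_⟩
      rw [neg_smul, ← smul_smul, eq_neg_of_add_eq_zero_left hab, smul_neg, neg_neg, smul_smul,
        inv_mul_cancel₀ hb, one_smul]
    refine ⟨?_, hb⟩
    simpa [hb, hx₁] using hab
  have hx₃' : ∀ a b : F, a • x₁ + b • x₂ ≠ x₃ := fun a b h =>
    hx₃ (Submodule.mem_span_pair.mpr ⟨a, b, h⟩)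
  have h123 : ∀ a b c : F, a • x₁ + b • x₂ + c • x₃ = 0 → a = 0 ∧ b = 0 ∧ c = 0 := by
    intro a b c habc
    have hc : c = 0 := by
      by_contra hc
      refine hx₃' (-(c⁻¹ * a)) (-(c⁻¹ * b)) ?_
      have : c • x₃ = -(a • x₁ + b • x₂) := eq_neg_of_add_eq_zero_right habc
      rw [← one_smul F x₃, ← inv_mul_cancel₀ hc, ← smul_smul, this]
      module
    obtain ⟨ha, hb⟩ := h12 a b (by simpa [hc] using habc)
    exact ⟨ha, hb, hc⟩
  have s12 := hB.swap x₂ x₁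
  have hy₄' : ∀ a b c : F, a • x₁ + b • x₂ + c • x₃ ≠ y₄ := by
    intro a b c h
    -- If `y₄` were dependent on `x₁, x₂, x₃`, the equation `B x₁ y₄ = B x₂ x₃` would make these two
    -- vectors commute, hence proportional.
    have hz : B (x₂ - c • x₁) (x₃ + b • x₁) = 0 := by
      have := hy₄
      rw [← h] at this
      simp only [map_add, map_smul, hB x₁] at this
      simp only [map_sub, map_add, map_smul, LinearMap.sub_apply, LinearMap.smul_apply, hB x₁,
        ← this, s12]
      module
    obtain ⟨a', ha'⟩ := hcomm _ _ (fun h0 => by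
      have := (h12 (-c) 1 (by rw [← h0]; module)).2
      simp at this) hz
    exact hx₃' (-(a' * c) - b) a' (by
      rw [← add_sub_cancel_right x₃ (b • x₁), ← ha']; module)
  have h1234 : ∀ a b c d : F, a • x₁ + b • x₂ + c • x₃ + d • y₄ = 0 →
      a = 0 ∧ b = 0 ∧ c = 0 ∧ d = 0 := by
    intro a b c d habcd
    have hd : d = 0 := by
      by_contra hd
      refine hy₄' (-(d⁻¹ * a)) (-(d⁻¹ * b)) (-(d⁻¹ * c)) ?_
      have : d • y₄ = -(a • x₁ + b • x₂ + c • x₃) := eq_neg_of_add_eq_zero_right habcd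
      rw [← one_smul F y₄, ← inv_mul_cancel₀ hd, ← smul_smul, this]
      module
    obtain ⟨ha, hb, hc⟩ := h123 a b c (by simpa [hd] using habcd)
    exact ⟨ha, hb, hc, hd⟩
  let b₀ : Basis (Fin 4) F V := basisOfLinearIndependentOfCardEqFinrank
    (b := ![x₁, x₂, x₃, y₄]) (by
      rw [Fintype.linearIndependent_iff]
      intro g hg
      rw [Fin.sum_univ_four] at hg
      obtain ⟨g0, g1, g2, g3⟩ := h1234 _ _ _ _ hg
      intro i
      fin_cases i
      exacts [g0, g1, g2, g3]) (by rw [hV, Fintype.card_fin])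
  obtain ⟨m, hm⟩ := hle ⟨y₄, rfl⟩
  obtain ⟨a, b, c, hm'⟩ : ∃ a b c : F,
      B x₂ y₄ = a • B x₁ x₂ + b • B x₁ x₃ + c • B x₁ y₄ := by
    refine ⟨b₀.repr m 1, b₀.repr m 2, b₀.repr m 3, ?_⟩
    rw [← hm]
    conv_lhs => rw [← b₀.sum_repr m]
    rw [Fin.sum_univ_four]
    simp [b₀, hB x₁]
  -- Completing the square: the shifts remove the `B x₁ x₂` and `B x₁ y₄` terms of `B x₂ y₄`, and `4
  -- s = c ^ 2 + 4 b` is the discriminant.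
  set X := x₂ - (c / 2) • x₁ with hX
  set Y := y₄ - (c / 2) • x₃ + a • x₁ with hY
  set s := b + c ^ 2 / 4 with hs
  have h4' : (4 : F) ≠ 0 := by
    rw [show (4 : F) = 2 * 2 by norm_num]; exact mul_ne_zero h2 h2
  have r1 : B X x₃ = B x₁ Y := by
    simp only [hX, hY, map_sub, map_add, map_smul, LinearMap.sub_apply, LinearMap.smul_apply,
      hB x₁, hy₄]
    module
  have r2 : B X Y = s • B x₁ x₃ := by
    simp only [hX, hY, hs, map_sub, map_add, map_smul, LinearMap.sub_apply, LinearMap.smul_apply,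
      hB x₁, hm', s12, ← hy₄]
    match_scalars <;> field_simp <;> ring
  have hsq : ¬ IsSquare s := by
    rintro ⟨r, hr⟩
    -- With `s = r * r` the relation `B X Y = s • B x₁ x₃` factors into a vanishing bracket.
    have hz : B (X - r • x₁) (Y + r • x₃) = 0 := by
      simp only [map_sub, map_add, map_smul, LinearMap.sub_apply, LinearMap.smul_apply, r1, r2, hr]
      module
    obtain ⟨a', ha'⟩ := hcomm _ _ (fun h0 => by
      have := (h12 (-(c / 2) - r) 1 (by rw [← h0, hX]; module)).2
      simp at this) hz
    have := (h1234 (a' * (-(c / 2) - r) - a) a' (c / 2 - r) (-1) (by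
      rw [← sub_eq_zero.mpr ha', hX, hY]; module)).2.2.2
    simp at this
  have ht0 : t ≠ 0 := by rintro rfl; exact ht (IsSquare.zero)
  obtain ⟨κ, hκ⟩ : IsSquare (s * t) := by
    classical
    have := Fintype.ofFinite F
    rw [← quadraticChar_one_iff_isSquare (mul_ne_zero (by rintro h; exact hsq (h ▸ IsSquare.zero)) ht0),
      map_mul, quadraticChar_neg_one_iff_not_isSquare.mpr hsq,
      quadraticChar_neg_one_iff_not_isSquare.mpr ht]
    norm_num
  have hκ0 : κ ≠ 0 := by
    rintro rfl
    have : s = 0 := by simpa [ht0] using hκ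
    exact hsq (this ▸ IsSquare.zero)
  -- Scaling both `X` and `Y` by `κ⁻¹` keeps the first relation, and `s * t = κ * κ` turns the
  -- second coefficient into `t`.
  refine ⟨![x₁, κ⁻¹ • Y, x₃, κ⁻¹ • X], ?_, ?_, ?_⟩
  · rw [Fintype.linearIndependent_iff]
    intro g hg
    rw [Fin.sum_univ_four] at hg
    obtain ⟨g0, g1, g2, g3⟩ := h1234 (g 0 + g 1 * κ⁻¹ * a - g 3 * κ⁻¹ * (c / 2)) (g 3 * κ⁻¹)
      (g 2 - g 1 * κ⁻¹ * (c / 2)) (g 1 * κ⁻¹) (by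
        rw [← hg, hX, hY]
        simp
        module)
    have t1 : g 1 = 0 := by simpa [hκ0] using g3
    have t3 : g 3 = 0 := by simpa [hκ0] using g1
    have t0 : g 0 = 0 := by simpa [t1, t3] using g0
    have t2 : g 2 = 0 := by simpa [t1] using g2
    intro i
    fin_cases i
    exacts [t0, t1, t2, t3]
  · have := hB.swap x₃ X
    simp [this, r1]
  · have h : t * (κ⁻¹ * (κ⁻¹ * s)) = 1 := by field_simp; rw [mul_comm, hκ]; ring
    have := hB.swap Y X
    simp [this, r2, smul_smul, h]

end NormalForms

/-! ### Breadth under isomorphisms and abelian factors; the Camina case. -/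

section Breadth

variable {F L M : Type*} [Field F] [LieRing L] [LieAlgebra F L] [LieRing M] [LieAlgebra F M]

theorem lieBreadth_eq_finrank_range (x : L) :
    lieBreadth F x = finrank F (LinearMap.range (LieAlgebra.ad F L x : L →ₗ[F] L)) :=
  (LinearMap.quotKerEquivRange (LieAlgebra.ad F L x : L →ₗ[F] L)).finrank_eq

/-- If the image of `ad x` is the isomorphic image of a subspace, the breadth of `x` is the
dimension of that subspace. -/
theorem lieBreadth_eq_of_range_eq_map {W : Type*} [AddCommGroup W] [Module F W] (x : L)
    {f : W →ₗ[F] L} (hf : Function.Injective f) (U : Submodule F W)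
    (h : LinearMap.range (LieAlgebra.ad F L x : L →ₗ[F] L) = U.map f) :
    lieBreadth F x = finrank F U := by
  rw [lieBreadth_eq_finrank_range, h]
  exact (Submodule.equivMapOfInjective f hf U).finrank_eq.symm

theorem lieBreadth_equiv (e : L ≃ₗ⁅F⁆ M) (x : L) : lieBreadth F (e x) = lieBreadth F x := by
  rw [lieBreadth_eq_finrank_range x]
  refine lieBreadth_eq_of_range_eq_map (e x) (f := (e : L →ₗ⁅F⁆ M).toLinearMap) e.injective _ ?_
  ext y
  simp only [LinearMap.mem_range, Submodule.mem_map]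
  constructor
  · rintro ⟨z, rfl⟩
    exact ⟨_, ⟨e.symm z, rfl⟩, by simp [LieAlgebra.ad_apply]⟩
  · rintro ⟨_, ⟨z, rfl⟩, rfl⟩
    exact ⟨e z, by simp [LieAlgebra.ad_apply]⟩

theorem lieBreadthType_equiv (e : L ≃ₗ⁅F⁆ M) : lieBreadthType F L = lieBreadthType F M := by
  ext n
  constructor
  · rintro ⟨x, rfl⟩
    exact ⟨e x, lieBreadth_equiv e x⟩
  · rintro ⟨x, rfl⟩
    exact ⟨e.symm x, lieBreadth_equiv e.symm x⟩

theorem lieBreadth_prod [IsLieAbelian M] (x : L) (a : M) :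
    lieBreadth F (x, a) = lieBreadth F x := by
  rw [lieBreadth_eq_finrank_range x]
  refine lieBreadth_eq_of_range_eq_map (x, a) (f := LinearMap.inl F L M)
    LinearMap.inl_injective _ ?_
  ext y
  simp only [LinearMap.mem_range, Submodule.mem_map]
  constructor
  · rintro ⟨z, rfl⟩
    exact ⟨_, ⟨z.1, rfl⟩, Prod.ext rfl (LieModule.IsTrivial.trivial a z.2).symm⟩
  · rintro ⟨_, ⟨z, rfl⟩, rfl⟩
    exact ⟨(z, 0), by simp [LieAlgebra.ad_apply, LieAlgebra.Prod.bracket_apply]⟩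

theorem lieBreadthType_prod [IsLieAbelian M] :
    lieBreadthType F (L × M) = lieBreadthType F L := by
  ext n
  constructor
  · rintro ⟨⟨x, a⟩, rfl⟩
    exact ⟨x, (lieBreadth_prod x a).symm⟩
  · rintro ⟨x, rfl⟩
    exact ⟨(x, 0), lieBreadth_prod x 0⟩

theorem toSubmodule_lieDerived :
    (lieDerived F L).toSubmodule = Submodule.span F {z : L | ∃ x y : L, ⁅x, y⁆ = z} := by
  rw [lieDerived, LieSubmodule.lieIdeal_oper_eq_linear_span']
  simp

theorem isStepNilpotentLie_two_iff :
    IsStepNilpotentLie L 2 ↔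
      (∀ x y : L, y ∈ lieDerived F L → ⁅x, y⁆ = 0) ∧ lieDerived F L ≠ ⊥ := by
  have h1 : LieModule.lowerCentralSeries F L L 1 = lieDerived F L := by
    rw [LieModule.lowerCentralSeries_succ, LieModule.lowerCentralSeries_zero]
    rfl
  have h2 : LieModule.lowerCentralSeries F L L 2 = ⊥ ↔
      ∀ x y : L, y ∈ lieDerived F L → ⁅x, y⁆ = 0 := by
    rw [LieModule.lowerCentralSeries_succ, h1, LieSubmodule.lie_eq_bot_iff]
    simp
  rw [IsStepNilpotentLie, LieModule.nilpotencyLength_eq_succ_iff F, h1, h2, and_iff_right_iff_imp]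
  exact fun h => LieModule.IsNilpotent.mk (R := F) L (k := 2) (h2.mpr h.1)

/-- Class 2 makes the derived algebra central, giving breadth 0 on it; off it the image of `ad x` is
the whole derived algebra. Elements off it exist, for otherwise `L` would be abelian. -/
theorem lieBreadthType_of_isCaminaLie (h2 : IsStepNilpotentLie L 2) (hC : IsCaminaLie F L)
    (h3 : finrank F (lieDerived F L) = 3) : lieBreadthType F L = {0, 3} := by
  obtain ⟨hz, hne⟩ := (isStepNilpotentLie_two_iff (F := F)).mp h2
  have h0 : ∀ x ∈ lieDerived F L, lieBreadth F x = 0 := by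
    intro x hx
    rw [lieBreadth_eq_finrank_range]
    have : (LieAlgebra.ad F L x : L →ₗ[F] L) = 0 := by
      ext y
      rw [LieAlgebra.ad_apply, ← lie_skew, hz y x hx]
      simp
    rw [this, LinearMap.range_zero, finrank_bot]
  have hn : ∀ x ∉ lieDerived F L, lieBreadth F x = 3 := by
    intro x hx
    rw [lieBreadth_eq_finrank_range, ← h3]
    have : LinearMap.range (LieAlgebra.ad F L x : L →ₗ[F] L) = (lieDerived F L).toSubmodule :=
      SetLike.coe_injective (hC.2 x hx)
    rw [this]
    rfl
  obtain ⟨x, hx⟩ : ∃ x : L, x ∉ lieDerived F L := by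
    by_contra! h
    apply hne
    rw [← LieSubmodule.toSubmodule_eq_bot, toSubmodule_lieDerived, Submodule.span_eq_bot]
    rintro _ ⟨x, y, rfl⟩
    exact hz x y (h y)
  ext n
  constructor
  · rintro ⟨y, rfl⟩
    by_cases hy : y ∈ lieDerived F L
    · exact Or.inl (h0 y hy)
    · exact Or.inr (hn y hy)
  · rintro (rfl | rfl)
    · exact ⟨0, h0 0 (zero_mem _)⟩
    · exact ⟨x, hn x hx⟩

end Breadth

/-! ### The two-step Lie algebra of an alternating map. -/

section TwoStep

variable {F V W : Type*} [Field F] [AddCommGroup V] [Module F V] [AddCommGroup W] [Module F W]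

/-- The Lie algebra `V × W` with bracket `⁅(v, a), (w, b)⁆ = (0, B v w)` of an alternating map
`B : V × V → W`. -/
def TwoStepLie (B : V →ₗ[F] V →ₗ[F] W) (_ : B.IsAlt) : Type _ := V × W

namespace TwoStepLie

variable {B : V →ₗ[F] V →ₗ[F] W} {hB : B.IsAlt}

instance : AddCommGroup (TwoStepLie B hB) := inferInstanceAs (AddCommGroup (V × W))

instance : Module F (TwoStepLie B hB) := inferInstanceAs (Module F (V × W))

instance [FiniteDimensional F V] [FiniteDimensional F W] : Module.Finite F (TwoStepLie B hB) :=
  inferInstanceAs (Module.Finite F (V × W))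

variable (B hB) in
/-- The linear identification of `V × W` with its two-step Lie algebra. -/
def mk : (V × W) ≃ₗ[F] TwoStepLie B hB := LinearEquiv.refl F (V × W)

instance : Bracket (TwoStepLie B hB) (TwoStepLie B hB) where
  bracket x y := mk B hB (0, B ((mk B hB).symm x).1 ((mk B hB).symm y).1)

theorem bracket_def (x y : TwoStepLie B hB) :
    ⁅x, y⁆ = mk B hB (0, B ((mk B hB).symm x).1 ((mk B hB).symm y).1) := rfl

instance : LieRing (TwoStepLie B hB) where
  add_lie x y z := congrArg (mk B hB) (Prod.ext (add_zero (0 : V)).symm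
    (LinearMap.congr_fun (map_add B ((mk B hB).symm x).1 ((mk B hB).symm y).1) _))
  lie_add x y z := congrArg (mk B hB) (Prod.ext (add_zero (0 : V)).symm
    (map_add (B ((mk B hB).symm x).1) ((mk B hB).symm y).1 ((mk B hB).symm z).1))
  lie_self x := by simp [bracket_def, hB _]
  leibniz_lie x y z := by simp [bracket_def]

instance : LieAlgebra F (TwoStepLie B hB) where
  lie_smul t x y := congrArg (mk B hB) (Prod.ext (smul_zero t).symm
    (map_smul (B ((mk B hB).symm x).1) t ((mk B hB).symm y).1))

theorem bracket_mk (x y : V × W) : ⁅mk B hB x, mk B hB y⁆ = mk B hB (0, B x.1 y.1) := rfl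

variable (B hB) in
/-- The inclusion of `W` in the two-step Lie algebra `V × W`. -/
def inr : W →ₗ[F] TwoStepLie B hB := (mk B hB).toLinearMap ∘ₗ LinearMap.inr F V W

theorem inr_injective : Function.Injective (inr B hB) :=
  fun _ _ h => congrArg Prod.snd ((mk B hB).injective h)

theorem lieBreadth_mk (x : V × W) :
    lieBreadth F (mk B hB x) = finrank F (LinearMap.range (B x.1)) := by
  refine lieBreadth_eq_of_range_eq_map (mk B hB x)
    (f := inr B hB) inr_injective _ ?_
  ext y
  simp only [LinearMap.mem_range, Submodule.mem_map]
  constructor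
  · rintro ⟨z, rfl⟩
    exact ⟨_, ⟨((mk B hB).symm z).1, rfl⟩, rfl⟩
  · rintro ⟨_, ⟨z, rfl⟩, rfl⟩
    exact ⟨mk B hB (z, 0), rfl⟩

theorem lieBreadthType_eq [Nontrivial V]
    (h3 : ∀ v, v ≠ 0 → finrank F (LinearMap.range (B v)) = 3) :
    lieBreadthType F (TwoStepLie B hB) = {0, 3} := by
  have h0 : finrank F (LinearMap.range (B 0)) = 0 := by
    rw [map_zero, LinearMap.range_zero, finrank_bot]
  ext n
  constructor
  · rintro ⟨y, rfl⟩
    obtain ⟨⟨v, w⟩, rfl⟩ := (mk B hB).surjective y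
    change lieBreadth F (mk B hB (v, w)) ∈ _
    rw [lieBreadth_mk]
    by_cases hv : v = 0
    · left
      rw [hv, h0]
    · exact Or.inr (h3 v hv)
  · rintro (rfl | rfl)
    · exact ⟨mk B hB 0, (lieBreadth_mk 0).trans h0⟩
    · obtain ⟨v, hv⟩ := exists_ne (0 : V)
      exact ⟨mk B hB (v, 0), by simp only [lieBreadth_mk, h3 v hv]⟩

theorem toSubmodule_lieDerived_eq_map :
    (lieDerived F (TwoStepLie B hB)).toSubmodule =
      (Submodule.span F {w | ∃ x y, B x y = w}).map (inr B hB) := by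
  rw [toSubmodule_lieDerived, Submodule.map_span]
  congr 1
  ext z
  simp only [Set.mem_ofPred_eq, Set.mem_image]
  constructor
  · rintro ⟨x, y, rfl⟩
    exact ⟨_, ⟨((mk B hB).symm x).1, ((mk B hB).symm y).1, rfl⟩, rfl⟩
  · rintro ⟨_, ⟨x, y, rfl⟩, rfl⟩
    exact ⟨mk B hB (x, 0), mk B hB (y, 0), rfl⟩

variable (hS : Submodule.span F {w | ∃ x y, B x y = w} = ⊤)
include hS

theorem mk_mem_lieDerived (x : V × W) : mk B hB x ∈ lieDerived F (TwoStepLie B hB) ↔ x.1 = 0 := by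
  rw [← LieSubmodule.mem_toSubmodule, toSubmodule_lieDerived_eq_map, hS]
  constructor
  · rintro ⟨w, -, hw⟩
    rw [← (mk B hB).injective hw]
    rfl
  · intro h
    exact ⟨x.2, trivial, by rw [← Prod.mk.eta (p := x), h]; rfl⟩

theorem finrank_lieDerived : finrank F (lieDerived F (TwoStepLie B hB)) = finrank F W := by
  change finrank F (lieDerived F (TwoStepLie B hB)).toSubmodule = _
  rw [toSubmodule_lieDerived_eq_map, hS, ← finrank_top F W]
  exact (Submodule.equivMapOfInjective _ inr_injective ⊤).finrank_eq.symm

theorem isStepNilpotentLie_two [Nontrivial W] : IsStepNilpotentLie (TwoStepLie B hB) 2 := by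
  rw [isStepNilpotentLie_two_iff (F := F)]
  constructor
  · intro x y hy
    obtain ⟨y, rfl⟩ := (mk B hB).surjective y
    rw [mk_mem_lieDerived hS] at hy
    rw [bracket_def, LinearEquiv.symm_apply_apply, hy, map_zero]
    exact map_zero _
  · intro h
    obtain ⟨w, hw⟩ := exists_ne (0 : W)
    have := (mk_mem_lieDerived (hB := hB) hS (0, w)).mpr rfl
    rw [h, LieSubmodule.mem_bot, LinearEquiv.map_eq_zero_iff] at this
    exact hw (congrArg Prod.snd this)

theorem isCaminaLie [FiniteDimensional F V] [FiniteDimensional F W]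
    (h : ∀ v, v ≠ 0 → LinearMap.range (B v) = ⊤) : IsCaminaLie F (TwoStepLie B hB) := by
  refine ⟨inferInstance, fun x hx => ?_⟩
  obtain ⟨x, rfl⟩ := (mk B hB).surjective x
  rw [mk_mem_lieDerived hS] at hx
  ext z
  obtain ⟨z, rfl⟩ := (mk B hB).surjective z
  rw [SetLike.mem_coe, mk_mem_lieDerived hS]
  constructor
  · rintro ⟨y, hy⟩
    rw [← (mk B hB).injective hy]
  · intro hz
    obtain ⟨y, hy⟩ : z.2 ∈ LinearMap.range (B x.1) := by rw [h _ hx]; trivial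
    refine ⟨mk B hB (y, 0), ?_⟩
    change ⁅mk B hB x, mk B hB (y, 0)⁆ = mk B hB z
    rw [bracket_mk, ← Prod.mk.eta (p := z), hz, hy]

end TwoStepLie

end TwoStep

/-! ### Presentations by four generators. -/

section Free

variable {F : Type*} [Field F]

/-- A morphism of Lie algebras vanishing on an ideal factors through the quotient. -/
def LieIdeal.quotientLift {L M : Type*} [LieRing L] [LieAlgebra F L] [LieRing M] [LieAlgebra F M]
    (I : LieIdeal F L) (f : L →ₗ⁅F⁆ M) (h : I ≤ f.ker) : L ⧸ I →ₗ⁅F⁆ M :=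
  { I.toSubmodule.liftQ (f : L →ₗ[F] M) h with
    map_lie' := by
      intro x y
      obtain ⟨x, rfl⟩ := LieSubmodule.Quotient.surjective_mk' I x
      obtain ⟨y, rfl⟩ := LieSubmodule.Quotient.surjective_mk' I y
      exact f.map_lie x y }

/-- The induced surjection from `L ⧸ I` to `M` is bijective by dimension, so an upper bound on the
size of the presented algebra is enough. -/
theorem nonempty_lieEquiv_quotient {L M : Type*} [LieRing L] [LieAlgebra F L] [LieRing M]
    [LieAlgebra F M] [FiniteDimensional F M] (I : LieIdeal F L) [FiniteDimensional F (L ⧸ I)]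
    (f : L →ₗ⁅F⁆ M) (hf : Function.Surjective f) (h : I ≤ f.ker)
    (hle : finrank F (L ⧸ I) ≤ finrank F M) : Nonempty (M ≃ₗ⁅F⁆ (L ⧸ I)) := by
  have hs : Function.Surjective (I.quotientLift f h) := fun y => by
    obtain ⟨x, rfl⟩ := hf y
    exact ⟨LieSubmodule.Quotient.mk x, rfl⟩
  have he : finrank F (L ⧸ I) = finrank F M :=
    le_antisymm hle (LinearMap.finrank_le_finrank_of_surjective
      (f := (I.quotientLift f h : L ⧸ I →ₗ[F] M)) hs)
  have hi : Function.Injective (I.quotientLift f h) :=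
    (LinearMap.injective_iff_surjective_of_finrank_eq_finrank
      (f := (I.quotientLift f h : L ⧸ I →ₗ[F] M)) he).mpr hs
  exact ⟨(LieEquiv.ofBijective _ ⟨hi, hs⟩).symm⟩

namespace FreeTwoStepLie

variable {n : ℕ} {Q : Type*} [LieRing Q] [LieAlgebra F Q]

theorem lie_lie_eq_zero (x y z : FreeTwoStepLie F n) : ⁅x, ⁅y, z⁆⁆ = 0 := by
  obtain ⟨x, rfl⟩ := LieSubmodule.Quotient.surjective_mk' _ x
  obtain ⟨y, rfl⟩ := LieSubmodule.Quotient.surjective_mk' _ y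
  obtain ⟨z, rfl⟩ := LieSubmodule.Quotient.surjective_mk' _ z
  refine (LieSubmodule.Quotient.mk_eq_zero' (m := ⁅x, ⁅y, z⁆⁆)).mpr ?_
  exact LieSubmodule.lie_mem_lie (LieSubmodule.mem_top x)
    (LieSubmodule.lie_mem_lie (LieSubmodule.mem_top y) (LieSubmodule.mem_top z))

/-- The images of the generators together with the central elements `d` span a subalgebra. By the
universal property of the free Lie algebra the projection onto `Q` factors through it, so it is all
of `Q`. -/
theorem finite_and_finrank_le (f : FreeTwoStepLie F n →ₗ⁅F⁆ Q) (hf : Function.Surjective f)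
    {k : ℕ} (d : Fin k → Q) (hd : ∀ i (z : Q), ⁅z, d i⁆ = 0)
    (hbr : ∀ i j, i < j → ⁅f (gen F n i), f (gen F n j)⁆ ∈ Submodule.span F (Set.range d)) :
    Module.Finite F Q ∧ finrank F Q ≤ n + k := by
  set D := Submodule.span F (Set.range d) with hD
  set E := Submodule.span F (Set.range fun i => f (gen F n i)) with hE
  have hbr' : ∀ i j, ⁅f (gen F n i), f (gen F n j)⁆ ∈ D := by
    intro i j
    rcases lt_trichotomy i j with h | rfl | h
    · exact hbr i j h
    · rw [lie_self]; exact zero_mem _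
    · rw [← lie_skew]; exact neg_mem (hbr j i h)
  have hDz : ∀ z : Q, ∀ w ∈ D, ⁅z, w⁆ = 0 := by
    intro z w hw
    have : D ≤ LinearMap.ker (LieAlgebra.ad F Q z : Q →ₗ[F] Q) := by
      rw [hD, Submodule.span_le]
      rintro _ ⟨i, rfl⟩
      exact hd i z
    exact this hw
  have hEE : ∀ x ∈ E, ∀ y ∈ E, ⁅x, y⁆ ∈ D := by
    intro x hx y hy
    induction hx, hy using Submodule.span_induction₂ with
    | mem_mem x y hx hy =>
      obtain ⟨i, rfl⟩ := hx
      obtain ⟨j, rfl⟩ := hy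
      exact hbr' i j
    | zero_left y hy => rw [zero_lie]; exact zero_mem _
    | zero_right x hx => rw [lie_zero]; exact zero_mem _
    | add_left x y z _ _ _ h1 h2 => rw [add_lie]; exact add_mem h1 h2
    | add_right x y z _ _ _ h1 h2 => rw [lie_add]; exact add_mem h1 h2
    | smul_left r x y _ _ h => rw [smul_lie]; exact Submodule.smul_mem _ _ h
    | smul_right r x y _ _ h => rw [lie_smul]; exact Submodule.smul_mem _ _ h
  let S : LieSubalgebra F Q :=
    { E ⊔ D with
      lie_mem' := by
        intro x y hx hy
        obtain ⟨x, hxE, x', hx', rfl⟩ := Submodule.mem_sup.mp hx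
        obtain ⟨y, hyE, y', hy', rfl⟩ := Submodule.mem_sup.mp hy
        refine Submodule.mem_sup_right ?_
        rw [lie_add, add_lie, hDz _ y' hy', add_zero, ← lie_skew x' y, hDz _ x' hx', neg_zero,
          add_zero]
        exact hEE x hxE y hyE }
  have hS : ∀ i, f (gen F n i) ∈ S := fun i =>
    Submodule.mem_sup_left (Submodule.subset_span ⟨i, rfl⟩)
  let π : FreeLieAlgebra F (Fin n) →ₗ⁅F⁆ Q :=
    { (f : FreeTwoStepLie F n →ₗ[F] Q) ∘ₗ Submodule.mkQ _ with
      map_lie' := fun {x y} =>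
        f.map_lie (LieSubmodule.Quotient.mk x) (LieSubmodule.Quotient.mk y) }
  have hcomp : S.incl.comp (FreeLieAlgebra.lift F fun i => (⟨f (gen F n i), hS i⟩ : S)) = π := by
    apply FreeLieAlgebra.hom_ext
    intro i
    rw [LieHom.comp_apply, FreeLieAlgebra.lift_of_apply]
    rfl
  have htop : E ⊔ D = ⊤ := by
    rw [eq_top_iff]
    rintro q -
    obtain ⟨x, rfl⟩ := hf q
    obtain ⟨x, rfl⟩ := LieSubmodule.Quotient.surjective_mk' _ x
    change π x ∈ S
    rw [← hcomp]
    exact (FreeLieAlgebra.lift F fun i => (⟨f (gen F n i), hS i⟩ : S)) x |>.2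
  have fE : Module.Finite F E := Module.Finite.span_of_finite F (Set.finite_range _)
  have fD : Module.Finite F D := Module.Finite.span_of_finite F (Set.finite_range _)
  have fQ : Module.Finite F Q := by
    rw [Module.finite_def, ← htop]
    exact Submodule.FG.sup (Module.Finite.iff_fg.mp fE) (Module.Finite.iff_fg.mp fD)
  refine ⟨fQ, ?_⟩
  have h1 := Submodule.finrank_add_le_finrank_add_finrank E D
  have h2 : finrank F E ≤ n := by
    simpa [Set.finrank] using finrank_range_le_card (R := F) fun i => f (gen F n i)
  have h3 : finrank F D ≤ k := by
    simpa [Set.finrank] using finrank_range_le_card (R := F) d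
  rw [htop, finrank_top] at h1
  omega

section ToTwoStep

variable {V W : Type*} [AddCommGroup V] [Module F V] [AddCommGroup W] [Module F W]
  {B : V →ₗ[F] V →ₗ[F] W} (hB : B.IsAlt)

/-- The morphism from the free two-step nilpotent Lie algebra given by the images in `V` of the
generators. -/
noncomputable def toTwoStep (x : Fin n → V) : FreeTwoStepLie F n →ₗ⁅F⁆ TwoStepLie B hB :=
  LieIdeal.quotientLift _ (FreeLieAlgebra.lift F fun i => TwoStepLie.mk B hB (x i, 0)) (by
    rw [LieSubmodule.lie_le_iff]
    intro y _ z hz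
    have hle : (lieDerived F (FreeLieAlgebra F (Fin n))).toSubmodule ≤
        (LinearMap.ker (LieAlgebra.ad F (TwoStepLie B hB)
          (FreeLieAlgebra.lift F (fun i => TwoStepLie.mk B hB (x i, 0)) y) :
            TwoStepLie B hB →ₗ[F] TwoStepLie B hB)).comap
        (FreeLieAlgebra.lift F fun i => TwoStepLie.mk B hB (x i, 0)).toLinearMap := by
      rw [toSubmodule_lieDerived, Submodule.span_le]
      rintro _ ⟨a, b, rfl⟩
      simp [TwoStepLie.bracket_def]
    rw [LieHom.mem_ker, LieHom.map_lie]
    exact hle hz)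

theorem toTwoStep_gen (x : Fin n → V) (i : Fin n) :
    toTwoStep hB x (gen F n i) = TwoStepLie.mk B hB (x i, 0) :=
  FreeLieAlgebra.lift_of_apply _ i

theorem toTwoStep_lie_gen (x : Fin n → V) (i j : Fin n) :
    toTwoStep hB x ⁅gen F n i, gen F n j⁆ = TwoStepLie.inr B hB (B (x i) (x j)) := by
  rw [LieHom.map_lie, toTwoStep_gen, toTwoStep_gen]
  rfl

theorem toTwoStep_surjective (b : Basis (Fin n) F V)
    (hS : Submodule.span F {w | ∃ x y, B x y = w} = ⊤) :
    Function.Surjective (toTwoStep hB b) := by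
  set R := LinearMap.range (toTwoStep hB b).toLinearMap with hR
  have hv : ∀ v, TwoStepLie.mk B hB (v, 0) ∈ R := by
    have : (⊤ : Submodule F V) ≤
        R.comap ((TwoStepLie.mk B hB).toLinearMap ∘ₗ LinearMap.inl F V W) := by
      rw [← b.span_eq, Submodule.span_le]
      rintro _ ⟨i, rfl⟩
      exact ⟨gen F n i, toTwoStep_gen hB b i⟩
    exact fun v => this trivial
  have hw : ∀ w, TwoStepLie.inr B hB w ∈ R := by
    have : (⊤ : Submodule F W) ≤ R.comap (TwoStepLie.inr B hB) := by
      rw [← hS, Submodule.span_le]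
      rintro _ ⟨x, y, rfl⟩
      obtain ⟨p, hp⟩ := hv x
      obtain ⟨q, hq⟩ := hv y
      refine ⟨⁅p, q⁆, ?_⟩
      change toTwoStep hB b p = _ at hp
      change toTwoStep hB b q = _ at hq
      change toTwoStep hB b ⁅p, q⁆ = _
      rw [LieHom.map_lie, hp, hq]
      rfl
    exact fun w => this trivial
  intro y
  obtain ⟨⟨v, w⟩, rfl⟩ := (TwoStepLie.mk B hB).surjective y
  have := add_mem (hv v) (hw w)
  have e : TwoStepLie.mk B hB (v, w) = TwoStepLie.mk B hB (v, 0) + TwoStepLie.inr B hB w := by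
    rw [TwoStepLie.inr, LinearMap.comp_apply, LinearMap.inr_apply, LinearEquiv.coe_coe, ← map_add]
    simp
  rw [e]
  exact this

end ToTwoStep

section FourGenerators

theorem finite_and_finrank_le_ten :
    Module.Finite F (FreeTwoStepLie F 4) ∧ finrank F (FreeTwoStepLie F 4) ≤ 4 + 6 := by
  refine finite_and_finrank_le LieHom.id Function.surjective_id
    (fun k => ⁅gen F 4 (finFourPairs k).1, gen F 4 (finFourPairs k).2⁆)
    (fun i z => lie_lie_eq_zero _ _ _) ?_
  have hs : ∀ k, ⁅gen F 4 (finFourPairs k).1, gen F 4 (finFourPairs k).2⁆ ∈ Submodule.span F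
      (Set.range fun k => ⁅gen F 4 (finFourPairs k).1, gen F 4 (finFourPairs k).2⁆) :=
    fun k => Submodule.subset_span ⟨k, rfl⟩
  intro i j hij
  fin_cases i <;> fin_cases j <;>
    first
    | (exfalso; revert hij; decide)
    | exact hs 0
    | exact hs 1
    | exact hs 2
    | exact hs 3
    | exact hs 4
    | exact hs 5

variable (I : LieIdeal F (FreeTwoStepLie F 4))

/-- The image of a generator in a quotient of the free two-step nilpotent Lie algebra. -/
noncomputable abbrev quotGen (i : Fin 4) : FreeTwoStepLie F 4 ⧸ I :=
  LieSubmodule.Quotient.mk (gen F 4 i)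

/-- The projection of the free two-step nilpotent Lie algebra to a quotient. -/
noncomputable def quotHom : FreeTwoStepLie F 4 →ₗ⁅F⁆ FreeTwoStepLie F 4 ⧸ I :=
  { (LieSubmodule.Quotient.mk' I : FreeTwoStepLie F 4 →ₗ[F] FreeTwoStepLie F 4 ⧸ I) with
    map_lie' := fun {_ _} => rfl }

theorem quot_lie_lie_eq_zero (x y z : FreeTwoStepLie F 4 ⧸ I) : ⁅x, ⁅y, z⁆⁆ = 0 := by
  obtain ⟨x, rfl⟩ := LieSubmodule.Quotient.surjective_mk' _ x
  obtain ⟨y, rfl⟩ := LieSubmodule.Quotient.surjective_mk' _ y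
  obtain ⟨z, rfl⟩ := LieSubmodule.Quotient.surjective_mk' _ z
  exact congrArg (LieSubmodule.Quotient.mk' I) (lie_lie_eq_zero x y z)

theorem finite_and_finrank_quot_le {k : ℕ} (d : Fin k → FreeTwoStepLie F 4 ⧸ I)
    (hd : ∀ i, ∃ y z : FreeTwoStepLie F 4 ⧸ I, d i = ⁅y, z⁆)
    (hbr : ∀ i j, i < j → ⁅quotGen I i, quotGen I j⁆ ∈ Submodule.span F (Set.range d)) :
    Module.Finite F (FreeTwoStepLie F 4 ⧸ I) ∧ finrank F (FreeTwoStepLie F 4 ⧸ I) ≤ 4 + k := by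
  refine finite_and_finrank_le (quotHom I) (LieSubmodule.Quotient.surjective_mk' I) d ?_ hbr
  intro i x
  obtain ⟨y, z, h⟩ := hd i
  rw [h, quot_lie_lie_eq_zero]

theorem finite_and_finrank_idealOne_le :
    Module.Finite F (FreeTwoStepLie F 4 ⧸ idealOne F) ∧
      finrank F (FreeTwoStepLie F 4 ⧸ idealOne F) ≤ 4 + 5 := by
  let y := quotGen (idealOne F)
  have hrel : ⁅y 0, y 1⁆ + ⁅y 2, y 3⁆ = 0 :=
    LieSubmodule.Quotient.mk_eq_zero'.mpr (LieSubmodule.subset_lieSpan (Set.mem_singleton _))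
  let d := ![⁅y 0, y 2⁆, ⁅y 0, y 3⁆, ⁅y 1, y 2⁆, ⁅y 1, y 3⁆, ⁅y 2, y 3⁆]
  have hs : ∀ k, d k ∈ Submodule.span F (Set.range d) :=
    fun k => Submodule.subset_span ⟨k, rfl⟩
  refine finite_and_finrank_quot_le _ d (fun i => ?_) (fun i j hij => ?_)
  · fin_cases i <;> exact ⟨_, _, rfl⟩
  · fin_cases i <;> fin_cases j <;>
      first
      | (exfalso; revert hij; decide)
      | exact hs 0
      | exact hs 1
      | exact hs 2
      | exact hs 3
      | exact hs 4
      -- The pair omitted from `d` is recovered from the defining relation.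
      | exact (eq_neg_of_add_eq_zero_left hrel ▸ neg_mem (hs 4) :
          ⁅y 0, y 1⁆ ∈ Submodule.span F (Set.range d))

theorem finite_and_finrank_idealTwo_le (t : F) :
    Module.Finite F (FreeTwoStepLie F 4 ⧸ idealTwo F t) ∧
      finrank F (FreeTwoStepLie F 4 ⧸ idealTwo F t) ≤ 4 + 4 := by
  let y := quotGen (idealTwo F t)
  have hrel : ⁅y 0, y 1⁆ + ⁅y 2, y 3⁆ = 0 :=
    LieSubmodule.Quotient.mk_eq_zero'.mpr (LieSubmodule.subset_lieSpan (Set.mem_insert _ _))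
  have hrel' : ⁅y 0, y 2⁆ + t • ⁅y 1, y 3⁆ = 0 :=
    LieSubmodule.Quotient.mk_eq_zero'.mpr
      (LieSubmodule.subset_lieSpan (Set.mem_insert_of_mem _ (Set.mem_singleton _)))
  let d := ![⁅y 0, y 3⁆, ⁅y 1, y 2⁆, ⁅y 1, y 3⁆, ⁅y 2, y 3⁆]
  have hs : ∀ k, d k ∈ Submodule.span F (Set.range d) :=
    fun k => Submodule.subset_span ⟨k, rfl⟩
  refine finite_and_finrank_quot_le _ d (fun i => ?_) (fun i j hij => ?_)
  · fin_cases i <;> exact ⟨_, _, rfl⟩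
  · fin_cases i <;> fin_cases j <;>
      first
      | (exfalso; revert hij; decide)
      | exact hs 0
      | exact hs 1
      | exact hs 2
      | exact hs 3
      | exact (eq_neg_of_add_eq_zero_left hrel ▸ neg_mem (hs 3) :
          ⁅y 0, y 1⁆ ∈ Submodule.span F (Set.range d))
      | exact (eq_neg_of_add_eq_zero_left hrel' ▸ neg_mem (Submodule.smul_mem _ t (hs 2)) :
          ⁅y 0, y 2⁆ ∈ Submodule.span F (Set.range d))

variable {V W : Type*} [AddCommGroup V] [Module F V] [AddCommGroup W] [Module F W]
  [FiniteDimensional F V] [FiniteDimensional F W]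
  {B : V →ₗ[F] V →ₗ[F] W} (hB : B.IsAlt) (b : Basis (Fin 4) F V)
  (hS : Submodule.span F {w | ∃ x y, B x y = w} = ⊤)
include b

theorem finrank_twoStepLie : finrank F (TwoStepLie B hB) = 4 + finrank F W := by
  rw [← (TwoStepLie.mk B hB).finrank_eq, finrank_prod, finrank_eq_card_basis b, Fintype.card_fin]

include hS

theorem nonempty_equiv_free (hW : finrank F W = 6) :
    Nonempty (TwoStepLie B hB ≃ₗ⁅F⁆ FreeTwoStepLie F 4) := by
  obtain ⟨h1, h2⟩ := finite_and_finrank_le_ten (F := F)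
  have hs := toTwoStep_surjective hB b hS
  have he : finrank F (FreeTwoStepLie F 4) = finrank F (TwoStepLie B hB) :=
    le_antisymm (by rw [finrank_twoStepLie hB b, hW]; exact h2)
      (LinearMap.finrank_le_finrank_of_surjective (f := (toTwoStep hB b).toLinearMap) hs)
  have hi := (LinearMap.injective_iff_surjective_of_finrank_eq_finrank
      (f := (toTwoStep hB b).toLinearMap) he).mpr hs
  exact ⟨(LieEquiv.ofBijective _ ⟨hi, hs⟩).symm⟩

theorem nonempty_equiv_idealOne (hW : finrank F W = 5)
    (hrel : B (b 0) (b 1) + B (b 2) (b 3) = 0) :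
    Nonempty (TwoStepLie B hB ≃ₗ⁅F⁆ (FreeTwoStepLie F 4 ⧸ idealOne F)) := by
  obtain ⟨h1, h2⟩ := finite_and_finrank_idealOne_le (F := F)
  refine nonempty_lieEquiv_quotient _ (toTwoStep hB b) (toTwoStep_surjective hB b hS) ?_
    (by rw [finrank_twoStepLie hB b, hW]; exact h2)
  rw [idealOne, LieSubmodule.lieSpan_le, Set.singleton_subset_iff, SetLike.mem_coe,
    LieHom.mem_ker, map_add, toTwoStep_lie_gen, toTwoStep_lie_gen, ← map_add, hrel, map_zero]

theorem nonempty_equiv_idealTwo (t : F) (hW : finrank F W = 4)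
    (hrel : B (b 0) (b 1) + B (b 2) (b 3) = 0) (hrel' : B (b 0) (b 2) + t • B (b 1) (b 3) = 0) :
    Nonempty (TwoStepLie B hB ≃ₗ⁅F⁆ (FreeTwoStepLie F 4 ⧸ idealTwo F t)) := by
  obtain ⟨h1, h2⟩ := finite_and_finrank_idealTwo_le (F := F) t
  refine nonempty_lieEquiv_quotient _ (toTwoStep hB b) (toTwoStep_surjective hB b hS) ?_
    (by rw [finrank_twoStepLie hB b, hW]; exact h2)
  rw [idealTwo, LieSubmodule.lieSpan_le]
  rintro _ (rfl | rfl)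
  · rw [SetLike.mem_coe,
      LieHom.mem_ker, map_add, toTwoStep_lie_gen, toTwoStep_lie_gen, ← map_add, hrel, map_zero]
  · rw [SetLike.mem_coe, LieHom.mem_ker, map_add, map_smul, toTwoStep_lie_gen, toTwoStep_lie_gen,
      ← map_smul, ← map_add, hrel', map_zero]

end FourGenerators

end FreeTwoStepLie

end Free

/-! ### Models of the three quotients in Plücker coordinates. -/

section Wedge

variable {F : Type*} [Field F]

/-- The exterior product on `F⁴`, in Plücker coordinates. -/
def wedgeFour (F : Type*) [Field F] : (Fin 4 → F) →ₗ[F] (Fin 4 → F) →ₗ[F] (Fin 6 → F) :=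
  LinearMap.mk₂ F
    (fun v w k => v (finFourPairs k).1 * w (finFourPairs k).2 -
      v (finFourPairs k).2 * w (finFourPairs k).1)
    (fun v v' w => by ext k; simp only [Pi.add_apply]; ring)
    (fun c v w => by ext k; simp only [Pi.smul_apply, smul_eq_mul]; ring)
    (fun v w w' => by ext k; simp only [Pi.add_apply]; ring)
    (fun c v w => by ext k; simp only [Pi.smul_apply, smul_eq_mul]; ring)

theorem wedgeFour_apply (v w : Fin 4 → F) (k : Fin 6) :
    wedgeFour F v w k = v (finFourPairs k).1 * w (finFourPairs k).2 -
      v (finFourPairs k).2 * w (finFourPairs k).1 := rfl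

theorem wedgeFour_plucker (v w : Fin 4 → F) :
    wedgeFour F v w 0 * wedgeFour F v w 5 - wedgeFour F v w 1 * wedgeFour F v w 4 +
      wedgeFour F v w 2 * wedgeFour F v w 3 = 0 := by
  simp only [wedgeFour_apply, finFourPairs]
  simp
  ring

theorem mem_span_of_wedgeFour_eq_zero {v w : Fin 4 → F} (hv : v ≠ 0) (h : wedgeFour F v w = 0) :
    w ∈ Submodule.span F {v} := by
  have hp : ∀ i j : Fin 4, i ≠ j → ∃ k, finFourPairs k = (i, j) ∨ finFourPairs k = (j, i) := by
    decide
  have hij : ∀ i j, v i * w j = v j * w i := by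
    intro i j
    by_cases hne : i = j
    · rw [hne]
    · obtain ⟨k, hk⟩ := hp i j hne
      have hk0 := congrFun h k
      rw [wedgeFour_apply] at hk0
      rcases hk with hk | hk <;> simp only [hk, Pi.zero_apply] at hk0
      · linear_combination hk0
      · linear_combination -hk0
  obtain ⟨i, hi⟩ := Function.ne_iff.mp hv
  refine Submodule.mem_span_singleton.mpr ⟨w i / v i, ?_⟩
  ext j
  have hi' : v i ≠ 0 := hi
  rw [Pi.smul_apply, smul_eq_mul, div_mul_eq_mul_div, div_eq_iff hi']
  linear_combination -hij i j

variable {W : Type*} [AddCommGroup W] [Module F W] (φ : (Fin 6 → F) →ₗ[F] W)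

theorem wedgeFour_compr₂_isAlt : ((wedgeFour F).compr₂ φ).IsAlt := by
  intro v
  have : wedgeFour F v v = 0 := by
    ext k
    rw [wedgeFour_apply, Pi.zero_apply]
    ring
  rw [LinearMap.compr₂_apply, this, map_zero]

theorem wedgeFour_basis (k : Fin 6) :
    wedgeFour F (Pi.basisFun F (Fin 4) (finFourPairs k).1)
      (Pi.basisFun F (Fin 4) (finFourPairs k).2) = Pi.basisFun F (Fin 6) k := by
  ext l
  rw [wedgeFour_apply]
  simp only [Pi.basisFun_apply, Pi.single_apply]
  fin_cases k <;> fin_cases l <;> simp [finFourPairs]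

theorem span_wedgeFour_compr₂ (hφ : Function.Surjective φ) :
    Submodule.span F {w | ∃ x y, (wedgeFour F).compr₂ φ x y = w} = ⊤ := by
  rw [eq_top_iff, ← LinearMap.range_eq_top.mpr hφ, LinearMap.range_eq_map,
    ← (Pi.basisFun F (Fin 6)).span_eq, Submodule.map_span, Submodule.span_le]
  rintro _ ⟨_, ⟨k, rfl⟩, rfl⟩
  exact Submodule.subset_span ⟨_, _, congrArg φ (wedgeFour_basis k)⟩

/-- If `φ` kills no nonzero decomposable bivector, a nonzero `v` commutes only with its multiples.
-/
theorem finrank_range_wedgeFour_compr₂ (h : ∀ v w, φ (wedgeFour F v w) = 0 → wedgeFour F v w = 0)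
    {v : Fin 4 → F} (hv : v ≠ 0) :
    finrank F (LinearMap.range ((wedgeFour F).compr₂ φ v)) = 3 := by
  have hker : LinearMap.ker ((wedgeFour F).compr₂ φ v) = Submodule.span F {v} := by
    apply le_antisymm
    · exact fun w hw => mem_span_of_wedgeFour_eq_zero hv (h v w hw)
    · rw [Submodule.span_le, Set.singleton_subset_iff]
      exact wedgeFour_compr₂_isAlt φ v
  have := LinearMap.finrank_range_add_finrank_ker ((wedgeFour F).compr₂ φ v)
  rw [hker, finrank_span_singleton hv, finrank_fin_fun] at this
  omega

theorem lieBreadthType_wedgeFour_compr₂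
    (h : ∀ v w, φ (wedgeFour F v w) = 0 → wedgeFour F v w = 0) :
    lieBreadthType F (TwoStepLie _ (wedgeFour_compr₂_isAlt φ)) = {0, 3} :=
  TwoStepLie.lieBreadthType_eq fun _ hv => finrank_range_wedgeFour_compr₂ φ h hv

/-- The quotient of the exterior square of `F⁴` by `e₁ ∧ e₂ + e₃ ∧ e₄`. -/
def wedgeQuotientOne (F : Type*) [Field F] : (Fin 6 → F) →ₗ[F] (Fin 5 → F) where
  toFun p := ![p 1, p 2, p 3, p 4, p 0 - p 5]
  map_add' p q := by ext i; fin_cases i <;> simp; ring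
  map_smul' c p := by ext i; fin_cases i <;> simp; ring

/-- The quotient of the exterior square of `F⁴` by `e₁ ∧ e₂ + e₃ ∧ e₄` and
`e₁ ∧ e₃ + t e₂ ∧ e₄`. -/
def wedgeQuotientTwo (t : F) : (Fin 6 → F) →ₗ[F] (Fin 4 → F) where
  toFun p := ![p 2, p 3, p 0 - p 5, p 4 - t * p 1]
  map_add' p q := by ext i; fin_cases i <;> simp <;> ring
  map_smul' c p := by ext i; fin_cases i <;> simp <;> ring

theorem wedgeQuotientOne_surjective : Function.Surjective (wedgeQuotientOne F) := by
  intro w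
  refine ⟨![w 4, w 0, w 1, w 2, w 3, 0], ?_⟩
  ext i
  fin_cases i <;> simp [wedgeQuotientOne]

theorem wedgeQuotientTwo_surjective (t : F) : Function.Surjective (wedgeQuotientTwo t) := by
  intro w
  refine ⟨![w 2, 0, w 0, w 1, w 3, 0], ?_⟩
  ext i
  fin_cases i <;> simp [wedgeQuotientTwo]

/-- On the kernel of the quotient map the Plücker form is the square of one coordinate. -/
theorem wedgeFour_eq_zero_of_wedgeQuotientOne (v w : Fin 4 → F)
    (h : wedgeQuotientOne F (wedgeFour F v w) = 0) : wedgeFour F v w = 0 := by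
  have hpl := wedgeFour_plucker v w
  have h0 : wedgeFour F v w 1 = 0 := congrFun h 0
  have h1 : wedgeFour F v w 2 = 0 := congrFun h 1
  have h2 : wedgeFour F v w 3 = 0 := congrFun h 2
  have h3 : wedgeFour F v w 4 = 0 := congrFun h 3
  have h4 : wedgeFour F v w 0 = wedgeFour F v w 5 := sub_eq_zero.mp (congrFun h 4)
  have h5 : wedgeFour F v w 5 = 0 := by simpa [h0, h1, h4] using hpl
  ext k
  fin_cases k
  exacts [h4.trans h5, h0, h1, h2, h3, h5]

/-- On the kernel of the quotient map the Plücker form is `a ^ 2 - t * b ^ 2`, anisotropic because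
`t` is not a square. -/
theorem wedgeFour_eq_zero_of_wedgeQuotientTwo {t : F} (ht : ¬ IsSquare t) (v w : Fin 4 → F)
    (h : wedgeQuotientTwo t (wedgeFour F v w) = 0) : wedgeFour F v w = 0 := by
  have hpl := wedgeFour_plucker v w
  have h0 : wedgeFour F v w 2 = 0 := congrFun h 0
  have h1 : wedgeFour F v w 3 = 0 := congrFun h 1
  have h2 : wedgeFour F v w 0 = wedgeFour F v w 5 := sub_eq_zero.mp (congrFun h 2)
  have h3 : wedgeFour F v w 4 = t * wedgeFour F v w 1 := sub_eq_zero.mp (congrFun h 3)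
  rw [h0, h2, h3, zero_mul, add_zero] at hpl
  have h4 : wedgeFour F v w 1 = 0 := by
    by_contra hne
    apply ht
    refine ⟨wedgeFour F v w 5 / wedgeFour F v w 1, ?_⟩
    field_simp
    linear_combination -hpl
  have h5 : wedgeFour F v w 5 = 0 := by simpa [h4] using hpl
  ext k
  fin_cases k
  exacts [h2.trans h5, h4, h0, h1, by simpa [h4] using h3, h5]

theorem lieBreadthType_freeTwoStepLie : lieBreadthType F (FreeTwoStepLie F 4) = {0, 3} := by
  obtain ⟨e⟩ := FreeTwoStepLie.nonempty_equiv_free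
    (wedgeFour_compr₂_isAlt (LinearMap.id : (Fin 6 → F) →ₗ[F] (Fin 6 → F)))
    (Pi.basisFun F (Fin 4)) (span_wedgeFour_compr₂ _ Function.surjective_id)
    (finrank_fin_fun F)
  rw [← lieBreadthType_equiv e]
  exact lieBreadthType_wedgeFour_compr₂ _ fun _ _ h => h

theorem lieBreadthType_quotient_idealOne :
    lieBreadthType F (FreeTwoStepLie F 4 ⧸ FreeTwoStepLie.idealOne F) = {0, 3} := by
  obtain ⟨e⟩ := FreeTwoStepLie.nonempty_equiv_idealOne
    (wedgeFour_compr₂_isAlt (wedgeQuotientOne F))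
    (Pi.basisFun F (Fin 4)) (span_wedgeFour_compr₂ _ wedgeQuotientOne_surjective)
    (finrank_fin_fun F) (by
      simp only [LinearMap.compr₂_apply]
      erw [wedgeFour_basis 0, wedgeFour_basis 5]
      ext i
      fin_cases i <;> simp [wedgeQuotientOne])
  rw [← lieBreadthType_equiv e]
  exact lieBreadthType_wedgeFour_compr₂ _ wedgeFour_eq_zero_of_wedgeQuotientOne

theorem lieBreadthType_quotient_idealTwo {t : F} (ht : ¬ IsSquare t) :
    lieBreadthType F (FreeTwoStepLie F 4 ⧸ FreeTwoStepLie.idealTwo F t) = {0, 3} := by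
  obtain ⟨e⟩ := FreeTwoStepLie.nonempty_equiv_idealTwo
    (wedgeFour_compr₂_isAlt (wedgeQuotientTwo t))
    (Pi.basisFun F (Fin 4)) (span_wedgeFour_compr₂ _ (wedgeQuotientTwo_surjective t)) t
    (finrank_fin_fun F) (by
      simp only [LinearMap.compr₂_apply]
      erw [wedgeFour_basis 0, wedgeFour_basis 5]
      ext i
      fin_cases i <;> simp [wedgeQuotientTwo]) (by
      simp only [LinearMap.compr₂_apply]
      erw [wedgeFour_basis 1, wedgeFour_basis 4]
      ext i
      fin_cases i <;> simp [wedgeQuotientTwo])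
  rw [← lieBreadthType_equiv e]
  exact lieBreadthType_wedgeFour_compr₂ _ (wedgeFour_eq_zero_of_wedgeQuotientTwo ht)

end Wedge

/-! ### From breadth type (0,3) to a two-step algebra. -/

section BreadthZeroThree

variable {F L : Type*} [Field F] [LieRing L] [LieAlgebra F L]

/-- The bracket of a Lie algebra, restricted to a subspace `C` and with values in the span of all
brackets. -/
def restrictedBracket (C : Submodule F L) :
    C →ₗ[F] C →ₗ[F] Submodule.span F {z : L | ∃ x y : L, ⁅x, y⁆ = z} :=
  LinearMap.mk₂ F (fun x y => ⟨⁅(x : L), (y : L)⁆, Submodule.subset_span ⟨_, _, rfl⟩⟩)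
    (fun _ _ _ => Subtype.ext (add_lie _ _ _)) (fun _ _ _ => Subtype.ext (smul_lie _ _ _))
    (fun _ _ _ => Subtype.ext (lie_add _ _ _)) (fun _ _ _ => Subtype.ext (lie_smul _ _ _))

theorem restrictedBracket_apply (C : Submodule F L) (x y : C) :
    (restrictedBracket C x y : L) = ⁅(x : L), (y : L)⁆ := rfl

theorem restrictedBracket_isAlt (C : Submodule F L) : (restrictedBracket C).IsAlt :=
  fun x => Subtype.ext (lie_self (x : L))

theorem mem_center_iff_forall_lie {x : L} :
    x ∈ (LieAlgebra.center F L).toSubmodule ↔ ∀ y : L, ⁅y, x⁆ = 0 :=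
  LieModule.mem_maxTrivSubmodule F L L x

theorem lie_center {x : L} (hx : x ∈ (LieAlgebra.center F L).toSubmodule) (y : L) : ⁅y, x⁆ = 0 :=
  mem_center_iff_forall_lie.mp hx y

theorem center_lie {x : L} (hx : x ∈ (LieAlgebra.center F L).toSubmodule) (y : L) :
    ⁅x, y⁆ = 0 := by
  rw [← lie_skew, lie_center hx, neg_zero]

variable {C : Submodule F L} (hC : IsCompl (LieAlgebra.center F L).toSubmodule C)
include hC

theorem exists_add_center (x : L) :
    ∃ c : C, ∃ z ∈ (LieAlgebra.center F L).toSubmodule, x = z + c := by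
  obtain ⟨z, hz, c, hc, h⟩ := Submodule.mem_sup.mp (show x ∈ _ ⊔ C by rw [hC.sup_eq_top]; trivial)
  exact ⟨⟨c, hc⟩, z, hz, h.symm⟩

theorem notMem_center_of_ne_zero {c : C} (hc : c ≠ 0) :
    (c : L) ∉ (LieAlgebra.center F L).toSubmodule := fun h =>
  hc (Subtype.ext (by simpa using hC.disjoint.le_bot (show (c : L) ∈ _ ⊓ C from ⟨h, c.2⟩)))

theorem span_restrictedBracket :
    Submodule.span F {w | ∃ x y, restrictedBracket C x y = w} = ⊤ := by
  apply Submodule.map_injective_of_injective (Submodule.injective_subtype _)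
  rw [Submodule.map_top, Submodule.range_subtype, Submodule.map_span]
  congr 1
  ext w
  constructor
  · rintro ⟨_, ⟨x, y, rfl⟩, rfl⟩
    exact ⟨x, y, rfl⟩
  · rintro ⟨x, y, rfl⟩
    obtain ⟨c, z, hz, rfl⟩ := exists_add_center hC x
    obtain ⟨c', z', hz', rfl⟩ := exists_add_center hC y
    exact ⟨_, ⟨c, c', rfl⟩, by simp [restrictedBracket_apply, lie_center hz', center_lie hz]⟩

theorem lieBreadth_eq_finrank_range_restrictedBracket (c : C) :
    lieBreadth F (c : L) = finrank F (LinearMap.range (restrictedBracket C c)) := by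
  refine lieBreadth_eq_of_range_eq_map _ (Submodule.injective_subtype _) _ ?_
  ext w
  simp only [LinearMap.mem_range, Submodule.mem_map]
  constructor
  · rintro ⟨x, rfl⟩
    obtain ⟨c', z, hz, rfl⟩ := exists_add_center hC x
    exact ⟨_, ⟨c', rfl⟩,
      by simp [restrictedBracket_apply, LieAlgebra.ad_apply, lie_center hz]⟩
  · rintro ⟨_, ⟨y, rfl⟩, rfl⟩
    exact ⟨y, rfl⟩

variable (hL : lieBreadthType F L = {0, 3})
include hL

theorem finrank_range_restrictedBracket [FiniteDimensional F L] {c : C} (hc : c ≠ 0) :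
    finrank F (LinearMap.range (restrictedBracket C c)) = 3 := by
  have hmem : lieBreadth F (c : L) ∈ lieBreadthType F L := ⟨_, rfl⟩
  rw [hL] at hmem
  rcases hmem with h | h
  · exfalso
    apply notMem_center_of_ne_zero hC hc
    rw [lieBreadth_eq_finrank_range, Submodule.finrank_eq_zero, LinearMap.range_eq_bot] at h
    rw [mem_center_iff_forall_lie]
    intro y
    rw [← lie_skew, ← LieAlgebra.ad_apply F, h]
    simp
  · rw [← lieBreadth_eq_finrank_range_restrictedBracket hC]
    exact h

theorem nontrivial_of_lieBreadthType : Nontrivial C := by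
  obtain ⟨x, hx⟩ : 3 ∈ lieBreadthType F L := by rw [hL]; simp
  obtain ⟨c, z, hz, rfl⟩ := exists_add_center hC x
  refine ⟨c, 0, ?_⟩
  rintro rfl
  change lieBreadth F _ = 3 at hx
  rw [lieBreadth_eq_finrank_range] at hx
  have : (LieAlgebra.ad F L (z + ((0 : C) : L)) : L →ₗ[F] L) = 0 := by
    ext y
    simp [LieAlgebra.ad_apply, center_lie hz]
  rw [this, LinearMap.range_zero, finrank_bot] at hx
  omega

/-- An element of the second centre commutes with all brackets; if the centre has codimension
four, the brackets thus lie in the span of that element and the centre. -/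
theorem lie_mem_span_add_center [FiniteDimensional F L] (h4 : finrank F C = 4) {c : C} (hc : c ≠ 0)
    (hcz : ∀ y : L, ⁅y, (c : L)⁆ ∈ (LieAlgebra.center F L).toSubmodule) (a b : L) :
    ∃ r : F, ⁅a, b⁆ - r • (c : L) ∈ (LieAlgebra.center F L).toSubmodule := by
  -- By the Jacobi identity; then the centralizer of `c` is `F c` plus the centre, because in
  -- dimension four the kernel of `B c` is a line.
  have h0 : ⁅(c : L), ⁅a, b⁆⁆ = 0 := by
    rw [leibniz_lie, ← lie_skew (c : L) a, ← lie_skew (c : L) b, neg_lie, lie_neg,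
      center_lie (hcz a), lie_center (hcz b)]
    simp
  obtain ⟨c', z, hz, h⟩ := exists_add_center hC ⁅a, b⁆
  rw [h, lie_add, lie_center hz, zero_add] at h0
  obtain ⟨r, hr⟩ := Submodule.mem_span_singleton.mp (mem_span_singleton_of_apply_eq_zero h4
    (restrictedBracket_isAlt C) (fun _ hv => finrank_range_restrictedBracket hC hL hv) hc
    (Subtype.ext h0 : restrictedBracket C c c' = 0))
  refine ⟨r, ?_⟩
  rw [h, ← hr]
  simpa using hz

/-- If one image contains all others, every noncentral element has the whole derived algebra as
image, so a noncentral bracket would be fixed by some `ad`, against nilpotency. If the centre has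
codimension 4, two elements `c`, `d` of the second centre, independent modulo the centre, confine
brackets to `F c + Z` and to `F d + Z`, hence to `Z`. -/
theorem lie_mem_center [Finite F] [FiniteDimensional F L] [LieRing.IsNilpotent L] (h2 : (2 : F) ≠ 0) (a b : L) :
    ⁅a, b⁆ ∈ (LieAlgebra.center F L).toSubmodule := by
  have hnt := nontrivial_of_lieBreadthType hC hL
  have h3 : ∀ v : C, v ≠ 0 → finrank F (LinearMap.range (restrictedBracket C v)) = 3 :=
    fun v hv => finrank_range_restrictedBracket hC hL hv
  have hB := restrictedBracket_isAlt C
  by_contra hab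
  rcases range_le_range_or_finrank_eq_four h2 hB h3 with ⟨x, hx, hle⟩ | h4
  · obtain ⟨c, z, hz, hc⟩ := exists_add_center hC ⁅a, b⁆
    have hc0 : c ≠ 0 := by
      rintro rfl
      apply hab
      rw [hc]
      simpa using hz
    have htop : LinearMap.range (restrictedBracket C c) = ⊤ := by
      rw [Submodule.eq_of_le_of_finrank_eq (hle c) (by rw [h3 c hc0, h3 x hx]),
        range_eq_top_of_forall_range_le (span_restrictedBracket hC) hle]
    obtain ⟨y, hy⟩ : (⟨⁅a, b⁆, Submodule.subset_span ⟨a, b, rfl⟩⟩ :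
        Submodule.span F {z : L | ∃ x y : L, ⁅x, y⁆ = z}) ∈
        LinearMap.range (restrictedBracket C c) := by rw [htop]; trivial
    have hy' : ⁅-(y : L), ⁅a, b⁆⁆ = ⁅a, b⁆ := by
      have : ⁅(c : L), (y : L)⁆ = ⁅a, b⁆ := congrArg Subtype.val hy
      conv_lhs => rw [hc]
      rw [lie_add, lie_center hz, zero_add, neg_lie, lie_skew, this]
    obtain ⟨k, hk⟩ := LieModule.isNilpotent_toEnd_of_isNilpotent F L L (-(y : L))
    have hpow : ∀ m : ℕ, (LieModule.toEnd F L L (-(y : L)) ^ m) ⁅a, b⁆ = ⁅a, b⁆ := by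
      intro m
      induction m with
      | zero => simp
      | succ m ih => rw [pow_succ, Module.End.mul_apply, LieModule.toEnd_apply_apply, hy', ih]
    apply hab
    rw [← hpow k, hk]
    exact zero_mem _
  · have : Nontrivial (L ⧸ LieAlgebra.center F L) := by
      refine ⟨LieSubmodule.Quotient.mk ⁅a, b⁆, 0, fun h => hab ?_⟩
      exact LieSubmodule.Quotient.mk_eq_zero'.mp h
    have : LieModule.IsNilpotent L (L ⧸ LieAlgebra.center F L) := by
      rw [LieModule.isNilpotent_quotient_iff F]
      obtain ⟨k, hk⟩ := LieModule.IsNilpotent.nilpotent F L L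
      exact ⟨k, by rw [hk]; exact bot_le⟩
    have := LieModule.nontrivial_max_triv_of_isNilpotent F L (L ⧸ LieAlgebra.center F L)
    obtain ⟨⟨q, hq⟩, hq0⟩ :=
      exists_ne (0 : LieModule.maxTrivSubmodule F L (L ⧸ LieAlgebra.center F L))
    obtain ⟨x, rfl⟩ := LieSubmodule.Quotient.surjective_mk' _ q
    obtain ⟨c, z, hz, rfl⟩ := exists_add_center hC x
    have hc0 : c ≠ 0 := by
      rintro rfl
      apply hq0
      apply Subtype.ext
      refine LieSubmodule.Quotient.mk_eq_zero'.mpr ?_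
      simpa using hz
    have hcz : ∀ y : L, ⁅y, (c : L)⁆ ∈ (LieAlgebra.center F L).toSubmodule := by
      intro y
      have h := (LieModule.mem_maxTrivSubmodule F L _ _).mp hq y
      have h' : ⁅y, z + (c : L)⁆ ∈ LieAlgebra.center F L :=
        LieSubmodule.Quotient.mk_eq_zero'.mp h
      rwa [lie_add, lie_center hz, zero_add] at h'
    have hcZ := notMem_center_of_ne_zero hC hc0
    -- All brackets lie in `F c + Z`, so `l` detects whether a bracket is central. The form `ω` has
    -- `c` in its radical, and a second radical vector `d` is again in the second centre.
    obtain ⟨l, hl, hlZ⟩ := Submodule.exists_le_ker_of_notMem hcZ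
    have hlc : ∀ u v : L, l ⁅u, v⁆ = 0 → ⁅u, v⁆ ∈ (LieAlgebra.center F L).toSubmodule := by
      intro u v huv
      obtain ⟨r, hr⟩ := lie_mem_span_add_center hC hL h4 hc0 hcz u v
      have hr0 : r = 0 := by
        have := hlZ hr
        rw [LinearMap.mem_ker, map_sub, huv, map_smul, zero_sub, neg_eq_zero, smul_eq_mul] at this
        exact (mul_eq_zero.mp this).resolve_right hl
      simpa [hr0] using hr
    set ω := (restrictedBracket C).compr₂ (l ∘ₗ Submodule.subtype _) with hω
    have hωapp : ∀ u v : C, ω u v = l ⁅(u : L), (v : L)⁆ := fun u v => rfl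
    obtain ⟨d, hd, hωd⟩ := exists_notMem_span_of_isAlt h4 (ω := ω)
      (fun v => by rw [hωapp, lie_self, map_zero]) hc0 (by
        ext v
        rw [hωapp, ← lie_skew, map_neg, hlZ (hcz v)]
        simp)
    have hd0 : d ≠ 0 := by rintro rfl; exact hd (zero_mem _)
    have hdz : ∀ y : L, ⁅y, (d : L)⁆ ∈ (LieAlgebra.center F L).toSubmodule := by
      intro y
      obtain ⟨c', z', hz', rfl⟩ := exists_add_center hC y
      rw [add_lie, center_lie hz', zero_add]
      apply hlc
      rw [← lie_skew, map_neg, ← hωapp, hωd]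
      simp
    obtain ⟨r, hr⟩ := lie_mem_span_add_center hC hL h4 hc0 hcz a b
    obtain ⟨s, hs⟩ := lie_mem_span_add_center hC hL h4 hd0 hdz a b
    have hrs : ((s • d - r • c : C) : L) ∈ (LieAlgebra.center F L).toSubmodule := by
      have := sub_mem hr hs
      rw [sub_sub_sub_cancel_left] at this
      simpa using this
    have hrs0 : s • d - r • c = 0 := by
      by_contra h
      exact notMem_center_of_ne_zero hC h hrs
    have hs0 : s = 0 := by
      by_contra h
      apply hd
      refine Submodule.mem_span_singleton.mpr ⟨s⁻¹ * r, ?_⟩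
      rw [← smul_smul, ← sub_eq_zero.mp hrs0, smul_smul, inv_mul_cancel₀ h, one_smul]
    apply hab
    simpa [hs0] using hs

omit hL in
/-- A Lie algebra whose brackets are central is the product of the two-step Lie algebra of its
bracket on a complement of the centre with an abelian Lie algebra. -/
theorem exists_equiv_twoStepLie_prod
    (hZ : ∀ a b : L, ⁅a, b⁆ ∈ (LieAlgebra.center F L).toSubmodule) :
    ∃ A : LieSubalgebra F L, IsLieAbelian A ∧
      Nonempty (L ≃ₗ⁅F⁆ TwoStepLie _ (restrictedBracket_isAlt C) × A) := by
  set S := Submodule.span F {z : L | ∃ x y : L, ⁅x, y⁆ = z} with hS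
  set Z := (LieAlgebra.center F L).toSubmodule with hZdef
  have hSZ : S ≤ Z := by
    rw [hS, Submodule.span_le]
    rintro _ ⟨a, b, rfl⟩
    exact hZ a b
  obtain ⟨T, hT⟩ := Submodule.exists_isCompl S
  -- Modular law: `T ⊓ Z` is a complement of `S` within the centre and serves as the abelian factor.
  have hsup : S ⊔ T ⊓ Z = Z := by
    rw [← sup_inf_assoc_of_le T hSZ, hT.sup_eq_top, top_inf_eq]
  let A : LieSubalgebra F L :=
    { T ⊓ Z with
      lie_mem' := by
        intro x y _ hy
        rw [lie_center (F := F) hy.2]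
        exact zero_mem (T ⊓ Z) }
  have hAZ : ∀ a : A, (a : L) ∈ Z := fun a => a.2.2
  have hsZ : ∀ s : S, (s : L) ∈ Z := fun s => hSZ s.2
  refine ⟨A, ⟨fun x y => Subtype.ext (lie_center (hAZ y) x)⟩, ?_⟩
  let f : TwoStepLie _ (restrictedBracket_isAlt C) × A →ₗ[F] L :=
    LinearMap.coprod ((C.subtype.coprod S.subtype) ∘ₗ
      (TwoStepLie.mk _ (restrictedBracket_isAlt C)).symm.toLinearMap) A.toSubmodule.subtype
  have hf : ∀ (c : C) (s : S) (a : A),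
      f (TwoStepLie.mk _ (restrictedBracket_isAlt C) (c, s), a) = c + s + a := fun _ _ _ => rfl
  let g : TwoStepLie _ (restrictedBracket_isAlt C) × A →ₗ⁅F⁆ L :=
    { f with
      map_lie' := by
        rintro ⟨x, a⟩ ⟨y, b⟩
        obtain ⟨⟨c, s⟩, rfl⟩ := (TwoStepLie.mk _ (restrictedBracket_isAlt C)).surjective x
        obtain ⟨⟨d, r⟩, rfl⟩ := (TwoStepLie.mk _ (restrictedBracket_isAlt C)).surjective y
        change f (TwoStepLie.mk _ _ (0, restrictedBracket C c d), ⁅a, b⁆) =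
          ⁅f (TwoStepLie.mk _ _ (c, s), a), f (TwoStepLie.mk _ _ (d, r), b)⁆
        rw [hf, hf, hf]
        simp only [add_lie, lie_add, lie_center (hAZ b), lie_center (hsZ r), center_lie (hAZ a),
          center_lie (hsZ s), LieSubalgebra.coe_bracket, restrictedBracket_apply]
        simp }
  have hinj : Function.Injective g := by
    rw [injective_iff_map_eq_zero]
    rintro ⟨x, a⟩ h
    obtain ⟨⟨c, s⟩, rfl⟩ := (TwoStepLie.mk _ (restrictedBracket_isAlt C)).surjective x
    have h' : (c : L) + s + a = 0 := h
    have hc : c = 0 := by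
      by_contra hc
      apply notMem_center_of_ne_zero hC hc
      rw [add_assoc] at h'
      rw [eq_neg_of_add_eq_zero_left h']
      exact neg_mem (add_mem (hsZ s) (hAZ a))
    subst hc
    rw [ZeroMemClass.coe_zero, zero_add] at h'
    have hs : (s : L) ∈ S ⊓ T := ⟨s.2, by
      rw [eq_neg_of_add_eq_zero_left h']; exact neg_mem a.2.1⟩
    rw [hT.inf_eq_bot, Submodule.mem_bot] at hs
    rw [hs, zero_add] at h'
    rw [show s = 0 from Subtype.ext hs, show a = 0 from Subtype.ext h']
    rfl
  have hsurj : Function.Surjective g := by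
    intro x
    obtain ⟨c, z, hz, rfl⟩ := exists_add_center hC x
    obtain ⟨s, hs, a, ha, rfl⟩ := Submodule.mem_sup.mp (show z ∈ S ⊔ T ⊓ Z by rwa [hsup])
    refine ⟨(TwoStepLie.mk _ (restrictedBracket_isAlt C) (c, ⟨s, hs⟩), ⟨a, ha⟩), ?_⟩
    change (c : L) + s + a = s + a + c
    abel
  exact ⟨(LieEquiv.ofBijective g ⟨hinj, hsurj⟩).symm⟩

end BreadthZeroThree

/-! ### The classification. -/

theorem theorem1p1 {F : Type u} {L : Type v} [Field F] [Finite F] (hF : ringChar F ≠ 2)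
    [LieRing L] [LieAlgebra F L] [Module.Finite F L] [LieRing.IsNilpotent L]
    (t : F) (ht : ¬ IsSquare t) :
    lieBreadthType F L = {0, 3} ↔
      ∃ (g I : Type v) (_ : LieRing g) (_ : LieAlgebra F g) (_ : LieRing I) (_ : LieAlgebra F I),
        Nonempty (L ≃ₗ⁅F⁆ g × I) ∧ IsLieAbelian I ∧
        ((IsStepNilpotentLie g 2 ∧ IsCaminaLie F g ∧
            Module.finrank F (lieDerived F g) = 3) ∨
          Nonempty (g ≃ₗ⁅F⁆ FreeTwoStepLie F 4) ∨
          Nonempty (g ≃ₗ⁅F⁆ (FreeTwoStepLie F 4 ⧸ FreeTwoStepLie.idealOne F)) ∨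
          Nonempty (g ≃ₗ⁅F⁆ (FreeTwoStepLie F 4 ⧸ FreeTwoStepLie.idealTwo F t))) := by
  constructor
  · intro hL
    have h2 : (2 : F) ≠ 0 := Ring.two_ne_zero hF
    obtain ⟨C, hC⟩ := Submodule.exists_isCompl (LieAlgebra.center F L).toSubmodule
    obtain ⟨A, hA, ⟨e⟩⟩ := exists_equiv_twoStepLie_prod hC (lie_mem_center hC hL h2)
    have hnt := nontrivial_of_lieBreadthType hC hL
    have h3 : ∀ v : C, v ≠ 0 → finrank F (LinearMap.range (restrictedBracket C v)) = 3 :=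
      fun v hv => finrank_range_restrictedBracket hC hL hv
    have hB := restrictedBracket_isAlt C
    have hS := span_restrictedBracket hC
    set W := Submodule.span F {z : L | ∃ x y : L, ⁅x, y⁆ = z} with hW
    refine ⟨TwoStepLie _ hB, A, inferInstance, inferInstance, inferInstance, inferInstance,
      ⟨e⟩, hA, ?_⟩
    have hge : 3 ≤ finrank F W := by
      obtain ⟨v, hv⟩ := exists_ne (0 : C)
      rw [← h3 v hv]
      exact Submodule.finrank_le _
    -- In dimension 3 every nonzero image fills `W`, which is the Camina condition; otherwise the
    -- dichotomy forces `dim C = 4`.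
    by_cases hW3 : finrank F W = 3
    · left
      have : Nontrivial W := Module.nontrivial_of_finrank_pos (R := F) (by omega)
      refine ⟨TwoStepLie.isStepNilpotentLie_two hS, TwoStepLie.isCaminaLie hS fun v hv => ?_,
        (TwoStepLie.finrank_lieDerived hS).trans hW3⟩
      exact Submodule.eq_top_of_finrank_eq ((h3 v hv).trans hW3.symm)
    · right
      have h4 : finrank F C = 4 := by
        rcases range_le_range_or_finrank_eq_four h2 hB h3 with ⟨x, hx, hle⟩ | h4
        · exfalso
          apply hW3
          rw [← h3 x hx, range_eq_top_of_forall_range_le hS hle, finrank_top]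
        · exact h4
      have hSW : finrank F (Submodule.span F {w | ∃ x y, restrictedBracket C x y = w}) =
          finrank F W := by rw [hS, finrank_top]
      have hle6 := finrank_span_apply_le_six hB (finBasisOfFinrankEq F C h4)
      rw [hSW] at hle6
      have hcard : Fintype.card (Fin 4) = finrank F C := by rw [h4, Fintype.card_fin]
      obtain h | h | h : finrank F W = 6 ∨ finrank F W = 5 ∨ finrank F W = 4 := by omega
      · exact Or.inl (FreeTwoStepLie.nonempty_equiv_free hB (finBasisOfFinrankEq F C h4) hS h)
      · obtain ⟨x, hx, hr⟩ := exists_linearIndependent_relation h4 hB h3 (by omega)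
        refine Or.inr (Or.inl (FreeTwoStepLie.nonempty_equiv_idealOne hB
          (basisOfLinearIndependentOfCardEqFinrank hx hcard) hS h ?_))
        simpa using hr
      · obtain ⟨x, hx, hr, hr'⟩ :=
          exists_linearIndependent_two_relations h2 ht h4 hB h3 (by omega)
        refine Or.inr (Or.inr (FreeTwoStepLie.nonempty_equiv_idealTwo hB
          (basisOfLinearIndependentOfCardEqFinrank hx hcard) hS t h ?_ ?_))
        · simpa using hr
        · simpa using hr'
  · rintro ⟨g, I, _, _, _, _, ⟨e⟩, hI, h⟩
    rw [lieBreadthType_equiv e, lieBreadthType_prod]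
    rcases h with ⟨h2, hc, h3⟩ | ⟨⟨e'⟩⟩ | ⟨⟨e'⟩⟩ | ⟨⟨e'⟩⟩
    · exact lieBreadthType_of_isCaminaLie h2 hc h3
    · rw [lieBreadthType_equiv e', lieBreadthType_freeTwoStepLie]
    · rw [lieBreadthType_equiv e', lieBreadthType_quotient_idealOne]
    · rw [lieBreadthType_equiv e', lieBreadthType_quotient_idealTwo ht]
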